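/- **Setting.** For $n\ge 1$ cut each cell $[\frac in,\frac{i+1}n]\times[\frac jn,\frac{j+1}n]$, $0\le i,j<n$, of the closed unit square into the two triangles with vertices $(\frac in,\frac jn),(\frac{i+1}n,\frac jn),(\frac in,\frac{j+1}n)$ and $(\frac{i+1}n,\frac jn),(\frac{i+1}n,\frac{j+1}n),(\frac in,\frac{j+1}n)$ (Friedrichs–Keller triangulation of $\Omega=(0,1)^2$). Let $V_n$ be the space of continuous functions on $\overline\Omega$ that vanish on $\partial\Omega$ and coincide on each triangle with a polynomial of degree at most $2$. For each internal node, i.e. each point $(\frac k{2n},\frac l{2n})$ with $1\le k,l\le 2n-1$, let $\varphi_{(k,l)}\in V_n$ be the function equal to $1$ at this node and $0$ at all other internal nodes. The stiffness matrix (diffusion coefficient $a\equiv1$) is $$A_n(1,\Omega,\mathbb P_2)=\Big[\int_\Omega\nabla\varphi_q\cdot\nabla\varphi_p\Big]_{p,q},$$ of size $(2n-1)^2$, with $p,q$ running over the internal nodes. With $\alpha=\frac{16}3$, $\beta=\frac43$, $\gamma=4$ let, for $(\theta_1,\theta_2)\in[-\pi,\pi]^2$, $$\mathbf f_{\mathbb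 P_2}(\theta_1,\theta_2)=\begin{bmatrix}\alpha&-\beta(1+e^{\mathrm i\theta_1})&-\beta(1+e^{\mathrm i\theta_2})&0\\-\beta(1+e^{-\mathrm i\theta_1})&\alpha&0&-\beta(1+e^{\mathrm i\theta_2})\\-\beta(1+e^{-\mathrm i\theta_2})&0&\alpha&-\beta(1+e^{\mathrm i\theta_1})\\0&-\beta(1+e^{-\mathrm i\theta_2})&-\beta(1+e^{-\mathrm i\theta_1})&\gamma+\frac\beta2(\cos\theta_1+\cos\theta_2)\end{bmatrix},$$ and let $T_n(\mathbf f_{\mathbb P_2})=[\hat{\mathbf f}_{\mathbf i-\mathbf j}]_{\mathbf i,\mathbf j\in\{1,\dots,n\}^2}$ be the $4n^2\times4n^2$ two-level block Toeplitz matrix with blocks $\hat{\mathbf f}_{\mathbf k}=\frac1{(2\pi)^2}\int_{[-\pi,\pi]^2}\mathbf f_{\mathbb P_2}(\boldsymbol\theta)e^{-\mathrm i(k_1\theta_1+k_2\theta_2)}\,d\boldsymbol\theta$. **Proposition.** Both $\{T_n(\mathbf f_{\mathbb P_2})\}_n$ and $\{A_n(1,\Omega,\mathbb P_2)\}_n$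 have the spectral (eigenvalue) distribution described by $\mathbf f_{\mathbb P_2}$ on $D=[-\pi,\pi]^2$: if $\{B_n\}_n$ is either of these two sequences, $d_n$ is the size of $B_n$, and $\lambda_i(\cdot)$ denotes the eigenvalues counted with multiplicity, then for every continuous compactly supported $F:\mathbb C\to\mathbb C$ $$\lim_{n\to\infty}\frac1{d_n}\sum_{i=1}^{d_n}F(\lambda_i(B_n))=\frac1{(2\pi)^2}\int_{[-\pi,\pi]^2}\frac{\sum_{i=1}^4F(\lambda_i(\mathbf f_{\mathbb P_2}(\boldsymbol\theta)))}4\,d\boldsymbol\theta .$$ -/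

import Mathlib

open MeasureTheory Filter Topology Set

noncomputable section

/-! Spectral distribution of a sequence of matrices -/

/-- The sum of `F` over all eigenvalues of a complex matrix, counted with algebraic
multiplicity. -/
def eigSum {ι : Type*} [Fintype ι] [DecidableEq ι] (F : ℂ → ℂ) (A : Matrix ι ι ℂ) : ℂ :=
  (A.charpoly.roots.map F).sum

/-- The sequence `A n` of square matrices (of size `Fintype.card (ι n)`) has the spectral
(eigenvalue) distribution described by the matrix-valued function `f` on the set `D`. The first
four fields are the standing requirements on the symbol, together with the fact that the
integral in the limit relation is a genuine one; `F` runs through the continuous compactly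
supported functions on `ℂ`. -/
structure HasSpectralDistribution {ι : ℕ → Type*} [∀ n, Fintype (ι n)] [∀ n, DecidableEq (ι n)]
    (A : ∀ n, Matrix (ι n) (ι n) ℂ) {E : Type*} [MeasureSpace E] (D : Set E)
    {r : Type*} [Fintype r] [DecidableEq r] (f : E → Matrix r r ℂ) : Prop where
  measure_pos : 0 < volume D
  measure_lt_top : volume D < ⊤
  aemeasurable : ∀ a b, AEMeasurable (fun x => f x a b) (volume.restrict D)
  integrable : ∀ F : ℂ → ℂ, Continuous F → HasCompactSupport F →
    IntegrableOn (fun x => eigSum F (f x) / (Fintype.card r : ℂ)) D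
  tendsto : ∀ F : ℂ → ℂ, Continuous F → HasCompactSupport F →
    Tendsto (fun n => (1 / (Fintype.card (ι n) : ℂ)) * eigSum F (A n)) atTop
      (𝓝 ((1 / (volume.real D : ℂ)) * ∫ x in D, eigSum F (f x) / (Fintype.card r : ℂ)))

/-! Two-level block Toeplitz matrices -/

/-- The square `[-π, π]²`. -/
def torusSquare : Set (ℝ × ℝ) := Icc (-Real.pi) Real.pi ×ˢ Icc (-Real.pi) Real.pi

/-- The Fourier coefficient of index `(k₁, k₂)` of a bivariate matrix-valued function, computed
componentwise. -/
def fourierCoeffMatrix {r : Type*} (f : ℝ × ℝ → Matrix r r ℂ) (k₁ k₂ : ℤ) : Matrix r r ℂ :=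
  Matrix.of fun a b => (1 / (2 * (Real.pi : ℂ)) ^ 2) *
    ∫ θ in torusSquare, f θ a b * Complex.exp (-Complex.I * ((k₁ : ℂ) * θ.1 + (k₂ : ℂ) * θ.2))

/-- The two-level block Toeplitz matrix of multi-index `(n₁, n₂)` generated by `f`: its block in
position `(i, j)` is the Fourier coefficient of index `i - j`. -/
def blockToeplitz {r : Type*} (n₁ n₂ : ℕ) (f : ℝ × ℝ → Matrix r r ℂ) :
    Matrix ((Fin n₁ × Fin n₂) × r) ((Fin n₁ × Fin n₂) × r) ℂ :=
  Matrix.of fun p q =>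
    fourierCoeffMatrix f (((p.1.1 : ℕ) : ℤ) - ((q.1.1 : ℕ) : ℤ))
      (((p.1.2 : ℕ) : ℤ) - ((q.1.2 : ℕ) : ℤ)) p.2 q.2

/-- The symbol of the quadratic finite element matrices, with `α = 16/3`, `β = 4/3`, `γ = 4`. -/
def symbolP2 (θ : ℝ × ℝ) : Matrix (Fin 4) (Fin 4) ℂ :=
  let α : ℂ := 16 / 3
  let β : ℂ := 4 / 3
  let γ : ℂ := 4
  let e₁ : ℂ := Complex.exp (Complex.I * θ.1)
  let e₂ : ℂ := Complex.exp (Complex.I * θ.2)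
  let e₁' : ℂ := Complex.exp (-Complex.I * θ.1)
  let e₂' : ℂ := Complex.exp (-Complex.I * θ.2)
  !![α, -β * (1 + e₁), -β * (1 + e₂), 0;
     -β * (1 + e₁'), α, 0, -β * (1 + e₂);
     -β * (1 + e₂'), 0, α, -β * (1 + e₁);
     0, -β * (1 + e₂'), -β * (1 + e₁'), γ + β / 2 * (Complex.cos θ.1 + Complex.cos θ.2)]

/-! Quadratic Lagrangian finite elements on the Friedrichs-Keller triangulation -/

/-- The domain `Ω = (0,1)²`. -/
def unitSquare : Set (ℝ × ℝ) := Ioo 0 1 ×ˢ Ioo 0 1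

/-- The lower left triangle of the mesh cell `(i, j)`, for mesh width `1 / N`. -/
def lowerTriangle (N i j : ℕ) : Set (ℝ × ℝ) :=
  convexHull ℝ {((i : ℝ) / N, (j : ℝ) / N), (((i : ℝ) + 1) / N, (j : ℝ) / N),
    ((i : ℝ) / N, ((j : ℝ) + 1) / N)}

/-- The upper right triangle of the mesh cell `(i, j)`, for mesh width `1 / N`. -/
def upperTriangle (N i j : ℕ) : Set (ℝ × ℝ) :=
  convexHull ℝ {(((i : ℝ) + 1) / N, (j : ℝ) / N), (((i : ℝ) + 1) / N, ((j : ℝ) + 1) / N),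
    ((i : ℝ) / N, ((j : ℝ) + 1) / N)}

/-- The Friedrichs-Keller triangulation of the closed unit square: each of the `N × N` square
cells is cut into two right-angled triangles, all the cuts being parallel. -/
def friedrichsKeller (N : ℕ) : Set (Set (ℝ × ℝ)) :=
  {K | ∃ i < N, ∃ j < N, K = lowerTriangle N i j ∨ K = upperTriangle N i j}

/-- The finite element space of degree `k`: functions that are continuous on the closed square,
coincide on each triangle with a polynomial of total degree at most `k`, and vanish on the
boundary. (Values outside the closed square are irrelevant.) -/
def femSpace (k N : ℕ) : Set (ℝ × ℝ → ℝ) :=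
  {φ | ContinuousOn φ (closure unitSquare) ∧
    (∀ K ∈ friedrichsKeller N, ∃ p : MvPolynomial (Fin 2) ℝ, p.totalDegree ≤ k ∧
      ∀ x ∈ K, φ x = MvPolynomial.eval ![x.1, x.2] p) ∧
    ∀ x ∈ frontier unitSquare, φ x = 0}

/-- Indices of the internal nodes (internal vertices and internal midpoints of edges) of the
quadratic elements. -/
abbrev P2Node (N : ℕ) : Type := Fin (2 * N - 1) × Fin (2 * N - 1)

/-- The position of an internal node: the points `(k / (2N), l / (2N))`, `1 ≤ k, l ≤ 2N - 1`. -/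
def P2Node.pos {N : ℕ} (m : P2Node N) : ℝ × ℝ :=
  ((((m.1 : ℕ) : ℝ) + 1) / (2 * N), (((m.2 : ℕ) : ℝ) + 1) / (2 * N))

/-! Existence of the nodal basis functions -/

/-- The piecewise linear hat function of the vertex `(a / N, b / N)`. -/
def hatFun (N a b : ℕ) (x : ℝ × ℝ) : ℝ :=
  max 0 (1 - max (max |N * x.1 - a| |N * x.2 - b|) |N * x.1 + N * x.2 - a - b|)

theorem continuous_hatFun (N a b : ℕ) : Continuous (hatFun N a b) := by
  unfold hatFun; fun_prop

theorem lowerTriangle_subset {N i j : ℕ} (hN : 0 < N) :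
    lowerTriangle N i j ⊆
      {x | (i : ℝ) ≤ N * x.1 ∧ (j : ℝ) ≤ N * x.2 ∧ N * x.1 + N * x.2 ≤ i + j + 1} := by
  have hN' : (0 : ℝ) < N := by exact_mod_cast hN
  refine convexHull_min ?_ ?_
  · rintro x (rfl | rfl | rfl) <;> simp only [mem_ofPred_eq] <;> field_simp <;>
      refine ⟨?_, ?_, ?_⟩ <;> linarith
  · rintro x ⟨h1, h2, h3⟩ y ⟨g1, g2, g3⟩ s t hs ht hst
    obtain rfl : t = 1 - s := by linarith
    simp only [mem_ofPred_eq, Prod.fst_add, Prod.snd_add, Prod.smul_fst, Prod.smul_snd, smul_eq_mul]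
    refine ⟨?_, ?_, ?_⟩ <;> nlinarith

theorem upperTriangle_subset {N i j : ℕ} (hN : 0 < N) :
    upperTriangle N i j ⊆
      {x | N * x.1 ≤ (i : ℝ) + 1 ∧ N * x.2 ≤ (j : ℝ) + 1 ∧ i + j + 1 ≤ N * x.1 + N * x.2} := by
  have hN' : (0 : ℝ) < N := by exact_mod_cast hN
  refine convexHull_min ?_ ?_
  · rintro x (rfl | rfl | rfl) <;> simp only [mem_ofPred_eq] <;> field_simp <;>
      refine ⟨?_, ?_, ?_⟩ <;> linarith
  · rintro x ⟨h1, h2, h3⟩ y ⟨g1, g2, g3⟩ s t hs ht hst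
    obtain rfl : t = 1 - s := by linarith
    simp only [mem_ofPred_eq, Prod.fst_add, Prod.snd_add, Prod.smul_fst, Prod.smul_snd, smul_eq_mul]
    refine ⟨?_, ?_, ?_⟩ <;> nlinarith

theorem hatFun_eq_zero {N a b : ℕ} {x : ℝ × ℝ}
    (h : N * x.1 ≤ (a : ℝ) - 1 ∨ (a : ℝ) + 1 ≤ N * x.1 ∨ N * x.2 ≤ (b : ℝ) - 1 ∨
      (b : ℝ) + 1 ≤ N * x.2 ∨ N * x.1 + N * x.2 ≤ (a : ℝ) + b - 1 ∨
      (a : ℝ) + b + 1 ≤ N * x.1 + N * x.2) : hatFun N a b x = 0 := by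
  unfold hatFun
  rw [max_eq_left]
  rw [sub_nonpos]
  simp only [le_max_iff, le_abs]
  rcases h with h | h | h | h | h | h
  · exact Or.inl (Or.inl (Or.inr (by linarith)))
  · exact Or.inl (Or.inl (Or.inl (by linarith)))
  · exact Or.inl (Or.inr (Or.inr (by linarith)))
  · exact Or.inl (Or.inr (Or.inl (by linarith)))
  · exact Or.inr (Or.inr (by linarith))
  · exact Or.inr (Or.inl (by linarith))

theorem hatFun_affine {N : ℕ} (a b : ℕ) {K : Set (ℝ × ℝ)} (hK : K ∈ friedrichsKeller N) :
    ∃ c d e : ℝ, ∀ x ∈ K, hatFun N a b x = c + d * x.1 + e * x.2 := by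
  obtain ⟨i, hi, j, hj, rfl | rfl⟩ := hK
  · have hs := lowerTriangle_subset (N := N) (i := i) (j := j) (by omega)
    by_cases h1 : a = i ∧ b = j
    · obtain ⟨rfl, rfl⟩ := h1
      refine ⟨1 + a + b, -N, -N, fun x hx => ?_⟩
      obtain ⟨g1, g2, g3⟩ := hs hx
      unfold hatFun
      rw [abs_of_nonneg (by linarith), abs_of_nonneg (by linarith), abs_of_nonneg (by linarith),
        max_eq_right (a := max _ _) (by simp only [max_le_iff]; constructor <;> linarith),
        max_eq_right (by linarith)]
      ring
    by_cases h2 : a = i + 1 ∧ b = j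
    · obtain ⟨rfl, rfl⟩ := h2
      refine ⟨-i, N, 0, fun x hx => ?_⟩
      obtain ⟨g1, g2, g3⟩ := hs hx
      unfold hatFun
      push_cast
      rw [abs_of_nonpos (by linarith), abs_of_nonneg (by linarith), abs_of_nonpos (by linarith),
        max_eq_left (a := max _ _) (by rw [le_max_iff]; left; linarith),
        max_eq_left (b := N * x.2 - b) (by linarith), max_eq_right (by linarith)]
      ring
    by_cases h3 : a = i ∧ b = j + 1
    · obtain ⟨rfl, rfl⟩ := h3
      refine ⟨-j, 0, N, fun x hx => ?_⟩
      obtain ⟨g1, g2, g3⟩ := hs hx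
      unfold hatFun
      push_cast
      rw [abs_of_nonneg (by linarith), abs_of_nonpos (by linarith), abs_of_nonpos (by linarith),
        max_eq_left (a := max _ _) (by rw [le_max_iff]; right; linarith),
        max_eq_right (a := N * x.1 - a) (by linarith), max_eq_right (by linarith)]
      ring
    · refine ⟨0, 0, 0, fun x hx => ?_⟩
      obtain ⟨g1, g2, g3⟩ := hs hx
      rw [hatFun_eq_zero]
      · ring
      have h : a + 1 ≤ i ∨ i + 2 ≤ a ∨ b + 1 ≤ j ∨ j + 2 ≤ b ∨ (i + j + 2 ≤ a + b) := by omega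
      rcases h with h | h | h | h | h <;> have h' : _ ≤ (_ : ℝ) := Nat.cast_le.mpr h <;>
        push_cast at h'
      · right; left; linarith
      · left; linarith
      · right; right; right; left; linarith
      · right; right; left; linarith
      · right; right; right; right; left; linarith
  · have hs := upperTriangle_subset (N := N) (i := i) (j := j) (by omega)
    by_cases h1 : a = i + 1 ∧ b = j + 1
    · obtain ⟨rfl, rfl⟩ := h1
      refine ⟨-1 - i - j, N, N, fun x hx => ?_⟩
      obtain ⟨g1, g2, g3⟩ := hs hx
      unfold hatFun
      push_cast
      rw [abs_of_nonpos (by linarith), abs_of_nonpos (by linarith), abs_of_nonpos (by linarith),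
        max_eq_right (a := max _ _) (by simp only [max_le_iff]; constructor <;> linarith),
        max_eq_right (by linarith)]
      ring
    by_cases h2 : a = i ∧ b = j + 1
    · obtain ⟨rfl, rfl⟩ := h2
      refine ⟨a + 1, -N, 0, fun x hx => ?_⟩
      obtain ⟨g1, g2, g3⟩ := hs hx
      unfold hatFun
      push_cast
      rw [abs_of_nonneg (by linarith), abs_of_nonpos (by linarith), abs_of_nonneg (by linarith),
        max_eq_left (a := max _ _) (by rw [le_max_iff]; left; linarith),
        max_eq_left (a := N * x.1 - a) (by linarith), max_eq_right (by linarith)]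
      ring
    by_cases h3 : a = i + 1 ∧ b = j
    · obtain ⟨rfl, rfl⟩ := h3
      refine ⟨b + 1, 0, -N, fun x hx => ?_⟩
      obtain ⟨g1, g2, g3⟩ := hs hx
      unfold hatFun
      push_cast
      rw [abs_of_nonpos (by linarith), abs_of_nonneg (by linarith), abs_of_nonneg (by linarith),
        max_eq_left (a := max _ _) (by rw [le_max_iff]; right; linarith),
        max_eq_right (b := N * x.2 - b) (by linarith), max_eq_right (by linarith)]
      ring
    · refine ⟨0, 0, 0, fun x hx => ?_⟩
      obtain ⟨g1, g2, g3⟩ := hs hx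
      rw [hatFun_eq_zero]
      · ring
      have h : a + 1 ≤ i ∨ i + 2 ≤ a ∨ b + 1 ≤ j ∨ j + 2 ≤ b ∨ (a + b ≤ i + j) := by omega
      rcases h with h | h | h | h | h <;> have h' : _ ≤ (_ : ℝ) := Nat.cast_le.mpr h <;>
        push_cast at h'
      · right; left; linarith
      · left; linarith
      · right; right; right; left; linarith
      · right; right; left; linarith
      · right; right; right; right; right; linarith

theorem exists_affine_mul {K : Set (ℝ × ℝ)} {f g : ℝ × ℝ → ℝ}
    (hf : ∃ c d e : ℝ, ∀ x ∈ K, f x = c + d * x.1 + e * x.2)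
    (hg : ∃ c d e : ℝ, ∀ x ∈ K, g x = c + d * x.1 + e * x.2) :
    ∃ p : MvPolynomial (Fin 2) ℝ, p.totalDegree ≤ 2 ∧
      ∀ x ∈ K, f x * g x = MvPolynomial.eval ![x.1, x.2] p := by
  have key : ∀ c d e : ℝ, (MvPolynomial.C c + MvPolynomial.C d * MvPolynomial.X 0 +
      MvPolynomial.C e * MvPolynomial.X 1 : MvPolynomial (Fin 2) ℝ).totalDegree ≤ 1 := by
    intro c d e
    refine (MvPolynomial.totalDegree_add _ _).trans (max_le ?_ ?_)
    · refine (MvPolynomial.totalDegree_add _ _).trans (max_le (by simp) ?_)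
      exact (MvPolynomial.totalDegree_mul _ _).trans (by simp)
    · exact (MvPolynomial.totalDegree_mul _ _).trans (by simp)
  obtain ⟨c, d, e, hf⟩ := hf
  obtain ⟨c', d', e', hg⟩ := hg
  refine ⟨_, (MvPolynomial.totalDegree_mul _ _).trans (add_le_add (key c d e) (key c' d' e')), ?_⟩
  intro x hx
  rw [hf x hx, hg x hx]
  simp

theorem hatFun_half {N a b k l : ℕ} {x : ℝ × ℝ} (h1 : N * x.1 = k / 2) (h2 : N * x.2 = l / 2) :
    hatFun N a b x = if k = 2 * a ∧ l = 2 * b then 1 else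
      if k ≤ 2 * a + 1 ∧ 2 * a ≤ k + 1 ∧ l ≤ 2 * b + 1 ∧ 2 * b ≤ l + 1 ∧
        k + l ≤ 2 * a + 2 * b + 1 ∧ 2 * a + 2 * b ≤ k + l + 1 then 1 / 2 else 0 := by
  split_ifs with h h'
  · obtain ⟨rfl, rfl⟩ := h
    have e1 : N * x.1 - a = 0 := by rw [h1]; push_cast; ring
    have e2 : N * x.2 - b = 0 := by rw [h2]; push_cast; ring
    have e3 : N * x.1 + N * x.2 - a - b = 0 := by linarith
    simp [hatFun, e1, e2, e3]
  · have hm : max (max |N * x.1 - a| |N * x.2 - b|) |N * x.1 + N * x.2 - a - b| = 1 / 2 := by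
      obtain ⟨g1, g2, g3, g4, g5, g6⟩ := h'
      have g1' : (k : ℝ) ≤ 2 * a + 1 := by exact_mod_cast g1
      have g2' : 2 * (a : ℝ) ≤ k + 1 := by exact_mod_cast g2
      have g3' : (l : ℝ) ≤ 2 * b + 1 := by exact_mod_cast g3
      have g4' : 2 * (b : ℝ) ≤ l + 1 := by exact_mod_cast g4
      have g5' : (k : ℝ) + l ≤ 2 * a + 2 * b + 1 := by exact_mod_cast g5
      have g6' : 2 * (a : ℝ) + 2 * b ≤ k + l + 1 := by exact_mod_cast g6
      apply le_antisymm
      · simp only [max_le_iff, abs_le]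
        refine ⟨⟨⟨?_, ?_⟩, ⟨?_, ?_⟩⟩, ⟨?_, ?_⟩⟩ <;> linarith
      · simp only [le_max_iff, le_abs]
        have : k = 2 * a + 1 ∨ k + 1 = 2 * a ∨ l = 2 * b + 1 ∨ l + 1 = 2 * b := by omega
        rcases this with g | g | g | g <;> have g' := congrArg (Nat.cast (R := ℝ)) g <;>
          push_cast at g'
        · exact Or.inl (Or.inl (Or.inl (by linarith)))
        · exact Or.inl (Or.inl (Or.inr (by linarith)))
        · exact Or.inl (Or.inr (Or.inl (by linarith)))
        · exact Or.inl (Or.inr (Or.inr (by linarith)))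
    rw [hatFun, hm]; norm_num
  · apply hatFun_eq_zero
    have : k + 2 ≤ 2 * a ∨ 2 * a + 2 ≤ k ∨ l + 2 ≤ 2 * b ∨ 2 * b + 2 ≤ l ∨
      k + l + 2 ≤ 2 * a + 2 * b ∨ 2 * a + 2 * b + 2 ≤ k + l := by omega
    rw [h1, h2]
    rcases this with g | g | g | g | g | g <;> have g' : _ ≤ (_ : ℝ) := Nat.cast_le.mpr g <;>
      push_cast at g'
    · left; linarith
    · right; left; linarith
    · right; right; left; linarith
    · right; right; right; left; linarith
    · right; right; right; right; left; linarith
    · right; right; right; right; right; linarith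

/-- For each internal node there is a function of the quadratic finite element space that equals
`1` at this node and `0` at all the other internal nodes. -/
theorem exists_nodalFun {N : ℕ} (m : P2Node N) :
    ∃ φ ∈ femSpace 2 N, ∀ m' : P2Node N, φ m'.pos = if m' = m then 1 else 0 := by
  obtain ⟨⟨k, hk⟩, ⟨l, hl⟩⟩ := m
  have hN : 0 < N := by omega
  have hN' : (0 : ℝ) < N := by exact_mod_cast hN
  obtain ⟨c, d, hcd⟩ : ∃ c d : ℝ, (k % 2 = 1 ∧ l % 2 = 1 → c = 2 ∧ d = -1) ∧
      (¬ (k % 2 = 1 ∧ l % 2 = 1) → c = 4 ∧ d = 0) := by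
    by_cases h : k % 2 = 1 ∧ l % 2 = 1
    · exact ⟨2, -1, by simp [h]⟩
    · exact ⟨4, 0, by simp [h]⟩
  set f := hatFun N ((k + 2) / 2) ((l + 1) / 2) with hf
  set g := hatFun N ((k + 1) / 2) ((l + 2) / 2) with hg
  refine ⟨fun x => f x * (c * g x + d), ⟨?_, ?_, ?_⟩, ?_⟩
  · have h1 := continuous_hatFun N ((k + 2) / 2) ((l + 1) / 2)
    have h2 := continuous_hatFun N ((k + 1) / 2) ((l + 2) / 2)
    exact (h1.mul ((continuous_const.mul h2).add continuous_const)).continuousOn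
  · intro K hK
    refine exists_affine_mul (hatFun_affine _ _ hK) ?_
    obtain ⟨c', d', e', h⟩ := hatFun_affine ((k + 1) / 2) ((l + 2) / 2) hK
    refine ⟨c * c' + d, c * d', c * e', fun x hx => ?_⟩
    rw [hg, h x hx]; ring
  · intro x hx
    have hx' : (x.1 = 0 ∨ x.1 = 1) ∨ (x.2 = 0 ∨ x.2 = 1) := by
      rw [unitSquare, frontier_prod_eq, frontier_Ioo zero_lt_one] at hx
      rcases hx with hx | hx
      · exact Or.inr hx.2
      · exact Or.inl hx.1
    by_cases hkl : k % 2 = 1 ∧ l % 2 = 1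
    · have hfx : f x = 0 := by
        apply hatFun_eq_zero
        have i1 : (1 : ℝ) ≤ ((k + 2) / 2 : ℕ) := by exact_mod_cast (by omega : 1 ≤ (k + 2) / 2)
        have i2 : (1 : ℝ) ≤ ((l + 1) / 2 : ℕ) := by exact_mod_cast (by omega : 1 ≤ (l + 1) / 2)
        have i3 : (((k + 2) / 2 : ℕ) : ℝ) + 1 ≤ N := by
          exact_mod_cast (by omega : (k + 2) / 2 + 1 ≤ N)
        have i4 : (((l + 1) / 2 : ℕ) : ℝ) + 1 ≤ N := by
          exact_mod_cast (by omega : (l + 1) / 2 + 1 ≤ N)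
        rcases hx' with (h | h) | (h | h) <;> rw [h]
        · left; linarith
        · right; left; linarith
        · right; right; left; linarith
        · right; right; right; left; linarith
      simp [hfx]
    · obtain ⟨rfl, rfl⟩ := hcd.2 hkl
      have i1 : (1 : ℝ) ≤ ((k + 2) / 2 : ℕ) := by exact_mod_cast (by omega : 1 ≤ (k + 2) / 2)
      have i2 : (1 : ℝ) ≤ ((l + 2) / 2 : ℕ) := by exact_mod_cast (by omega : 1 ≤ (l + 2) / 2)
      have i3 : (((k + 1) / 2 : ℕ) : ℝ) + 1 ≤ N := by
        exact_mod_cast (by omega : (k + 1) / 2 + 1 ≤ N)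
      have i4 : (((l + 1) / 2 : ℕ) : ℝ) + 1 ≤ N := by
        exact_mod_cast (by omega : (l + 1) / 2 + 1 ≤ N)
      have : f x = 0 ∨ g x = 0 := by
        rcases hx' with (h | h) | (h | h)
        · left; apply hatFun_eq_zero; rw [h]; left; linarith
        · right; apply hatFun_eq_zero; rw [h]; right; left; linarith
        · right; apply hatFun_eq_zero; rw [h]; right; right; left; linarith
        · left; apply hatFun_eq_zero; rw [h]; right; right; right; left; linarith
      rcases this with h | h <;> simp [h]
  · rintro ⟨⟨k', hk'⟩, ⟨l', hl'⟩⟩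
    have e1 : N * (P2Node.pos ((⟨k', hk'⟩, ⟨l', hl'⟩) : P2Node N)).1 = ((k' + 1 : ℕ) : ℝ) / 2 := by
      simp only [P2Node.pos]; push_cast; field_simp
    have e2 : N * (P2Node.pos ((⟨k', hk'⟩, ⟨l', hl'⟩) : P2Node N)).2 = ((l' + 1 : ℕ) : ℝ) / 2 := by
      simp only [P2Node.pos]; push_cast; field_simp
    simp only [hf, hg, hatFun_half e1 e2, Prod.mk.injEq, Fin.mk.injEq]
    by_cases hkl : k % 2 = 1 ∧ l % 2 = 1
    · obtain ⟨rfl, rfl⟩ := hcd.1 hkl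
      split_ifs <;> first | (exfalso; omega) | norm_num
    · obtain ⟨rfl, rfl⟩ := hcd.2 hkl
      split_ifs <;> first | (exfalso; omega) | norm_num

/-- The nodal basis function of an internal node: the function of the quadratic finite element
space that equals `1` at this node and `0` at all the other internal nodes. -/
def nodalBasis {N : ℕ} (m : P2Node N) : ℝ × ℝ → ℝ := (exists_nodalFun m).choose

/-- The stiffness matrix `A_n(a, Ω, ℙ₂)`, with entries `∫_Ω a ∇φ_j ⬝ ∇φ_i`. The classical gradient
exists off the edges of the mesh, and so almost everywhere. -/
def stiffnessP2 (a : ℝ × ℝ → ℝ) (N : ℕ) : Matrix (P2Node N) (P2Node N) ℝ :=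
  Matrix.of fun i j => ∫ x in unitSquare, a x *
    (fderiv ℝ (nodalBasis j) x (1, 0) * fderiv ℝ (nodalBasis i) x (1, 0) +
      fderiv ℝ (nodalBasis j) x (0, 1) * fderiv ℝ (nodalBasis i) x (0, 1))

end

noncomputable section

/-! Eigenvalue sums of Hermitian matrices and the moment method -/

/-! All matrices involved are Hermitian with uniformly bounded absolute row sums, so their
eigenvalues lie in one fixed real interval `[-c, c]`. By Weierstrass it then suffices to prove the
limit relation for monomials `F(z) = z ^ k`, that is, to find the limit of the normalized traces of
powers (`hasSpectralDistribution_of_moments`).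

For trigonometric polynomial symbols the moments come from circulants. Formal trigonometric
polynomials form a group algebra, and both evaluation at `θ` and passage to the circulant of order
`N` are ring homomorphisms on it. The trace of the `k`-th power of the symbol and that of the block
circulant are therefore images of the same element, the trace of `F ^ k`. The mean of the first over
the torus is its constant coefficient; the trace of the second is `N ^ 2` times that coefficient
once `N` exceeds the degree. A banded block Toeplitz matrix of order `n` is a principal submatrix of
the circulant of order `n + w`, `w` bounding the bandwidth, and deleting `d` rows and columns
changes the trace of a `k`-th power by at most `(k + 1) * c ^ k * d`
(`norm_trace_submatrix_pow_sub_le`). Here `d = o(n ^ 2)`, so the moments agree in the limit. The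
argument applies equally to principal submatrices of the Toeplitz matrix that lose few rows
(`hasSpectralDistribution_submatrix_blockToeplitz`).

The stiffness matrix is exactly such a submatrix. Numbering nodes by a block in `{0, …, n-1}²` and
the parities of their coordinates, each entry depends only on the two parity classes and the
difference of the blocks: the Dirichlet integral in the plane is invariant under scaling, and all
cells around an internal node lie in the square, so there is no boundary correction. A nodal basis
function is determined on each triangle by its six nodal values, which reduces every entry to sums
of integer local stiffnesses over 24; the comparison with the Fourier coefficients of the symbol is
a finite check (`sum_cellStiffness_of_mem`). Only `4n² - (2n-1)² = 4n - 1` indices are missing. -/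

theorem eigSum_eq_sum_eigenvalues {ι : Type*} [Fintype ι] [DecidableEq ι] {A : Matrix ι ι ℂ}
    (hA : A.IsHermitian) (F : ℂ → ℂ) : eigSum F A = ∑ i, F (hA.eigenvalues i) := by
  rw [eigSum, hA.roots_charpoly_eq_eigenvalues, Multiset.map_map]
  rfl

/-- Diagonalization is conjugation by a unitary, an algebra automorphism, so it commutes with
evaluating a polynomial and preserves the trace. -/
theorem eigSum_eval {ι : Type*} [Fintype ι] [DecidableEq ι] {A : Matrix ι ι ℂ}
    (hA : A.IsHermitian) (p : Polynomial ℂ) :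
    eigSum (fun z => p.eval z) A = (Polynomial.aeval A p).trace := by
  rw [eigSum_eq_sum_eigenvalues hA]
  conv_rhs => rw [hA.spectral_theorem]
  rw [Polynomial.aeval_algHom_apply (Unitary.conjStarAlgAut ℂ _ hA.eigenvectorUnitary),
    Unitary.conjStarAlgAut_apply, Matrix.trace_mul_comm, ← mul_assoc, Unitary.coe_star_mul_self,
    one_mul, ← Matrix.diagonalAlgHom_apply ℂ, Polynomial.aeval_algHom_apply]
  simp [Matrix.trace, Polynomial.aeval_pi]

/-- Gershgorin's argument: read the eigenvector equation in the coordinate where the eigenvector has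
largest modulus. -/
theorem abs_eigenvalues_le {ι : Type*} [Fintype ι] [DecidableEq ι] {A : Matrix ι ι ℂ}
    (hA : A.IsHermitian) {c : ℝ} (hc : ∀ i, ∑ j, ‖A i j‖ ≤ c) (i : ι) :
    |hA.eigenvalues i| ≤ c := by
  set v : ι → ℂ := WithLp.ofLp (hA.eigenvectorBasis i) with hv
  have hmul : A.mulVec v = hA.eigenvalues i • v := hA.mulVec_eigenvectorBasis i
  have hv0 : v ≠ 0 := by
    intro h
    apply hA.eigenvectorBasis.toBasis.ne_zero i
    rw [OrthonormalBasis.coe_toBasis]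
    ext k
    exact congrFun h k
  have : Nonempty ι := ⟨i⟩
  obtain ⟨k, hk⟩ := Finite.exists_max (fun k => ‖v k‖)
  have hpos : 0 < ‖v k‖ := by
    obtain ⟨l, hl⟩ := Function.ne_iff.mp hv0
    exact (norm_pos_iff.mpr hl).trans_le (hk l)
  have h1 := congrArg norm (congrFun hmul k)
  rw [Pi.smul_apply, norm_smul, Real.norm_eq_abs] at h1
  have h2 : ‖A.mulVec v k‖ ≤ c * ‖v k‖ := by
    calc ‖A.mulVec v k‖ ≤ ∑ j, ‖A k j * v j‖ := norm_sum_le _ _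
      _ ≤ ∑ j, ‖A k j‖ * ‖v k‖ := by
          refine Finset.sum_le_sum fun j _ => ?_
          rw [norm_mul]
          exact mul_le_mul_of_nonneg_left (hk j) (norm_nonneg _)
      _ ≤ c * ‖v k‖ := by
          rw [← Finset.sum_mul]
          exact mul_le_mul_of_nonneg_right (hc k) hpos.le
  rw [h1] at h2
  exact le_of_mul_le_mul_right h2 hpos

theorem norm_eigSum_sub_le {ι : Type*} [Fintype ι] [DecidableEq ι] {A : Matrix ι ι ℂ}
    (hA : A.IsHermitian) {c : ℝ} (hc : ∀ i, ∑ j, ‖A i j‖ ≤ c) {F G : ℂ → ℂ} {ε : ℝ}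
    (h : ∀ t : ℝ, |t| ≤ c → ‖F t - G t‖ ≤ ε) :
    ‖eigSum F A - eigSum G A‖ ≤ Fintype.card ι * ε := by
  rw [eigSum_eq_sum_eigenvalues hA, eigSum_eq_sum_eigenvalues hA, ← Finset.sum_sub_distrib]
  refine (norm_sum_le _ _).trans ?_
  refine (Finset.sum_le_sum fun i _ => h _ (abs_eigenvalues_le hA hc i)).trans ?_
  simp

/-- Weierstrass applied to real and imaginary parts. Approximation on a real interval is enough,
since only Hermitian spectra are fed into `F`. -/
theorem exists_complex_polynomial_near {F : ℂ → ℂ} (hF : Continuous F) (c : ℝ) {ε : ℝ}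
    (hε : 0 < ε) : ∃ p : Polynomial ℂ, ∀ t : ℝ, |t| ≤ c → ‖F t - p.eval (t : ℂ)‖ ≤ ε := by
  obtain ⟨p, hp⟩ := exists_polynomial_near_of_continuousOn (-c) c (fun t : ℝ => (F t).re)
    (by fun_prop) (ε / 2) (by positivity)
  obtain ⟨q, hq⟩ := exists_polynomial_near_of_continuousOn (-c) c (fun t : ℝ => (F t).im)
    (by fun_prop) (ε / 2) (by positivity)
  refine ⟨p.map (algebraMap ℝ ℂ) + Polynomial.C Complex.I * q.map (algebraMap ℝ ℂ),
    fun t ht => ?_⟩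
  have e : ∀ r : Polynomial ℝ, (r.map (algebraMap ℝ ℂ)).eval (t : ℂ) = ((r.eval t : ℝ) : ℂ) :=
    fun r => by
    rw [Polynomial.eval_map_algebraMap]
    exact Polynomial.aeval_algebraMap_apply_eq_algebraMap_eval t r
  have hp' := hp t (abs_le.mp ht)
  have hq' := hq t (abs_le.mp ht)
  rw [abs_sub_comm] at hp' hq'
  refine (Complex.norm_le_abs_re_add_abs_im _).trans ?_
  simp only [Polynomial.eval_add, Polynomial.eval_mul, Polynomial.eval_C, e]
  simp
  linarith

theorem trace_aeval {ι : Type*} [Fintype ι] [DecidableEq ι] (A : Matrix ι ι ℂ)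
    (p : Polynomial ℂ) :
    (Polynomial.aeval A p).trace = p.sum fun k a => a * (A ^ k).trace := by
  rw [Polynomial.aeval_eq_sum_range, Polynomial.sum_over_range _ (by simp), Matrix.trace_sum]
  simp [Matrix.trace_smul]

/-- The moment method. -/
theorem hasSpectralDistribution_of_moments {ι : ℕ → Type*} [∀ n, Fintype (ι n)]
    [∀ n, DecidableEq (ι n)] {A : ∀ n, Matrix (ι n) (ι n) ℂ} {E : Type*} [MeasureSpace E]
    [TopologicalSpace E] [OpensMeasurableSpace E] [T2Space E]
    [IsFiniteMeasureOnCompacts (volume : Measure E)] {D : Set E} (hD : IsCompact D)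
    (hD0 : 0 < volume D) {r : Type*} [Fintype r] [DecidableEq r] {f : E → Matrix r r ℂ}
    (hf : Continuous f) {c : ℝ} (hA : ∀ n, (A n).IsHermitian)
    (hAc : ∀ n i, ∑ j, ‖A n i j‖ ≤ c) (hfH : ∀ x, (f x).IsHermitian)
    (hfc : ∀ x i, ∑ j, ‖f x i j‖ ≤ c)
    (hmom : ∀ k : ℕ, Tendsto (fun n => (1 / (Fintype.card (ι n) : ℂ)) * (A n ^ k).trace) atTop
      (𝓝 ((1 / (volume.real D : ℂ)) * ∫ x in D, (f x ^ k).trace / (Fintype.card r : ℂ)))) :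
    HasSpectralDistribution A D f := by
  have hDlt : volume D < ⊤ := hD.measure_lt_top
  have hpolycont : ∀ p : Polynomial ℂ, Continuous fun x => eigSum (fun z => p.eval z) (f x) := by
    intro p
    have : (fun x => eigSum (fun z => p.eval z) (f x)) =
        fun x => p.sum fun k a => a * (f x ^ k).trace := by
      funext x
      rw [eigSum_eval (hfH x), trace_aeval]
    rw [this]
    simp only [Polynomial.sum]
    exact continuous_finsetSum _ fun k _ => continuous_const.mul (hf.pow k).matrix_trace
  -- Polynomial eigenvalue sums are traces, hence continuous in `x`; a general `F` gives a uniform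
  -- limit of these.
  have hcont : ∀ F : ℂ → ℂ, Continuous F → Continuous fun x => eigSum F (f x) := by
    intro F hF
    rw [continuous_iff_continuousAt]
    intro x
    rw [Metric.continuousAt_iff']
    intro ε hε
    -- The summand `1` in the denominator keeps the tolerance meaningful when `r` is empty.
    obtain ⟨p, hp⟩ := exists_complex_polynomial_near hF c
      (ε := ε / (3 * (Fintype.card r + 1))) (by positivity)
    have hb : ∀ y, ‖eigSum F (f y) - eigSum (fun z => p.eval z) (f y)‖ < ε / 3 := by
      intro y
      refine (norm_eigSum_sub_le (hfH y) (hfc y) hp).trans_lt ?_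
      rw [mul_div_assoc', div_lt_div_iff₀ (by positivity) (by positivity)]
      nlinarith
    have := Metric.continuousAt_iff'.mp ((hpolycont p).continuousAt (x := x)) (ε / 3) (by positivity)
    filter_upwards [this] with y hy
    rw [dist_eq_norm] at hy ⊢
    have h1 := hb y
    have h2 := hb x
    rw [norm_sub_rev] at h2
    calc _ = ‖(eigSum F (f y) - eigSum (fun z => p.eval z) (f y)) +
          (eigSum (fun z => p.eval z) (f y) - eigSum (fun z => p.eval z) (f x)) +
          (eigSum (fun z => p.eval z) (f x) - eigSum F (f x))‖ := by congr 1; ring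
      _ ≤ _ := norm_add₃_le
      _ < ε := by linarith
  have hint : ∀ F : ℂ → ℂ, Continuous F →
      IntegrableOn (fun x => eigSum F (f x) / (Fintype.card r : ℂ)) D := fun F hF =>
    ((hcont F hF).div_const _).continuousOn.integrableOn_compact hD
  have hpoly : ∀ p : Polynomial ℂ, Tendsto (fun n => (1 / (Fintype.card (ι n) : ℂ)) *
      eigSum (fun z => p.eval z) (A n)) atTop
      (𝓝 ((1 / (volume.real D : ℂ)) *
        ∫ x in D, eigSum (fun z => p.eval z) (f x) / (Fintype.card r : ℂ))) := by
    intro p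
    have e1 : (fun n => (1 / (Fintype.card (ι n) : ℂ)) * eigSum (fun z => p.eval z) (A n)) =
        fun n => ∑ k ∈ p.support, p.coeff k *
          ((1 / (Fintype.card (ι n) : ℂ)) * (A n ^ k).trace) := by
      funext n
      rw [eigSum_eval (hA n), trace_aeval, Polynomial.sum, Finset.mul_sum]
      exact Finset.sum_congr rfl fun k _ => by ring
    have e2 : (1 / (volume.real D : ℂ)) *
        ∫ x in D, eigSum (fun z => p.eval z) (f x) / (Fintype.card r : ℂ) =
        ∑ k ∈ p.support, p.coeff k * ((1 / (volume.real D : ℂ)) *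
          ∫ x in D, (f x ^ k).trace / (Fintype.card r : ℂ)) := by
      have : ∀ x, eigSum (fun z => p.eval z) (f x) / (Fintype.card r : ℂ) =
          ∑ k ∈ p.support, p.coeff k * ((f x ^ k).trace / (Fintype.card r : ℂ)) := by
        intro x
        rw [eigSum_eval (hfH x), trace_aeval, Polynomial.sum, Finset.sum_div]
        exact Finset.sum_congr rfl fun k _ => by ring
      simp_rw [this]
      rw [integral_finsetSum, Finset.mul_sum]
      · refine Finset.sum_congr rfl fun k _ => ?_
        rw [integral_const_mul]
        ring
      · intro k _
        exact (continuous_const.mul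
          ((hf.pow k).matrix_trace.div_const _)).continuousOn.integrableOn_compact hD
    rw [e1, e2]
    exact tendsto_finsetSum _ fun k _ => (hmom k).const_mul _
  refine ⟨hD0, hDlt, fun a b => (hf.matrix_elem a b).aemeasurable, fun F hF _ => hint F hF,
    fun F hF _ => ?_⟩
  have hvol : 0 < volume.real D := ENNReal.toReal_pos hD0.ne' hDlt.ne
  -- An inequality rather than an equality: matrices may have size `0`, where `1 / 0 = 0`.
  have hcardle : ∀ (m : ℕ) (δ : ℝ), 0 ≤ δ → (1 / (m : ℝ)) * (m * δ) ≤ δ := by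
    intro m δ hδ
    rcases Nat.eq_zero_or_pos m with rfl | hm
    · simpa using hδ
    · rw [← mul_assoc, one_div_mul_cancel (by positivity), one_mul]
  rw [Metric.tendsto_atTop']
  intro ε hε
  obtain ⟨p, hp⟩ := exists_complex_polynomial_near hF c (ε := ε / 4) (by positivity)
  obtain ⟨N, hN⟩ := Metric.tendsto_atTop'.mp (hpoly p) (ε / 4) (by positivity)
  refine ⟨N, fun n hn => ?_⟩
  have h1 : ‖(1 / (Fintype.card (ι n) : ℂ)) * eigSum F (A n) -
      (1 / (Fintype.card (ι n) : ℂ)) * eigSum (fun z => p.eval z) (A n)‖ ≤ ε / 4 := by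
    rw [← mul_sub, norm_mul]
    refine (mul_le_mul_of_nonneg_left (norm_eigSum_sub_le (hA n) (hAc n) hp)
      (norm_nonneg _)).trans ?_
    simpa using hcardle (Fintype.card (ι n)) (ε / 4) (by positivity)
  have h2 : ‖(1 / (volume.real D : ℂ)) *
        (∫ x in D, eigSum (fun z => p.eval z) (f x) / (Fintype.card r : ℂ)) -
      (1 / (volume.real D : ℂ)) * ∫ x in D, eigSum F (f x) / (Fintype.card r : ℂ)‖ ≤ ε / 4 := by
    rw [← mul_sub, ← integral_sub (((hpolycont p).div_const
      _).continuousOn.integrableOn_compact hD) (hint F hF), norm_mul]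
    have : ‖∫ x in D, (eigSum (fun z => p.eval z) (f x) / (Fintype.card r : ℂ) -
        eigSum F (f x) / (Fintype.card r : ℂ))‖ ≤ ε / 4 * volume.real D := by
      refine norm_setIntegral_le_of_norm_le_const hDlt fun x _ => ?_
      rw [← sub_div, norm_div, norm_sub_rev, div_eq_mul_one_div, mul_comm]
      refine (mul_le_mul_of_nonneg_left (norm_eigSum_sub_le (hfH x) (hfc x) hp)
        (by positivity)).trans ?_
      simpa using hcardle (Fintype.card r) (ε / 4) (by positivity)
    refine (mul_le_mul_of_nonneg_left this (norm_nonneg _)).trans (le_of_eq ?_)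
    rw [norm_div, norm_one, Complex.norm_real, Real.norm_of_nonneg hvol.le]
    field_simp
  have h3 := hN n hn
  rw [dist_eq_norm] at h3 ⊢
  calc _ = ‖((1 / (Fintype.card (ι n) : ℂ)) * eigSum F (A n) -
        (1 / (Fintype.card (ι n) : ℂ)) * eigSum (fun z => p.eval z) (A n)) +
        ((1 / (Fintype.card (ι n) : ℂ)) * eigSum (fun z => p.eval z) (A n) -
        (1 / (volume.real D : ℂ)) *
          ∫ x in D, eigSum (fun z => p.eval z) (f x) / (Fintype.card r : ℂ)) +
        ((1 / (volume.real D : ℂ)) *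
          (∫ x in D, eigSum (fun z => p.eval z) (f x) / (Fintype.card r : ℂ)) -
        (1 / (volume.real D : ℂ)) * ∫ x in D, eigSum F (f x) / (Fintype.card r : ℂ))‖ := by
        congr 1; ring
    _ ≤ _ := norm_add₃_le
    _ < ε := by linarith

/-! Matrices with bounded row sums and their principal submatrices -/

/-- The absolute row sums of `A` are at most `c`. -/
def RowSumLE {ι κ : Type*} [Fintype κ] (A : Matrix ι κ ℂ) (c : ℝ) : Prop :=
  ∀ i, ∑ j, ‖A i j‖ ≤ c

theorem RowSumLE.mul {ι κ μ : Type*} [Fintype κ] [Fintype μ] {A : Matrix ι κ ℂ}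
    {B : Matrix κ μ ℂ} {c d : ℝ} (hA : RowSumLE A c) (hB : RowSumLE B d) (hd : 0 ≤ d) :
    RowSumLE (A * B) (c * d) := by
  intro i
  calc ∑ j, ‖(A * B) i j‖ ≤ ∑ j, ∑ l, ‖A i l‖ * ‖B l j‖ := by
        refine Finset.sum_le_sum fun j _ => ?_
        rw [Matrix.mul_apply]
        refine (norm_sum_le _ _).trans (le_of_eq ?_)
        simp_rw [norm_mul]
    _ = ∑ l, ‖A i l‖ * ∑ j, ‖B l j‖ := by
        rw [Finset.sum_comm]
        simp_rw [Finset.mul_sum]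
    _ ≤ ∑ l, ‖A i l‖ * d :=
        Finset.sum_le_sum fun l _ => mul_le_mul_of_nonneg_left (hB l) (norm_nonneg _)
    _ ≤ c * d := by
        rw [← Finset.sum_mul]
        exact mul_le_mul_of_nonneg_right (hA i) hd

theorem rowSumLE_one {ι : Type*} [Fintype ι] [DecidableEq ι] :
    RowSumLE (1 : Matrix ι ι ℂ) 1 := by
  intro i
  refine le_of_eq ?_
  rw [Finset.sum_eq_single i] <;> simp +contextual [eq_comm]

theorem RowSumLE.pow {ι : Type*} [Fintype ι] [DecidableEq ι] {A : Matrix ι ι ℂ} {c : ℝ}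
    (hA : RowSumLE A c) (hc : 0 ≤ c) (k : ℕ) : RowSumLE (A ^ k) (c ^ k) := by
  induction k with
  | zero => simpa using rowSumLE_one
  | succ k ih =>
    rw [pow_succ, pow_succ]
    exact ih.mul hA hc

theorem RowSumLE.submatrix {ι κ : Type*} [Fintype ι] [Fintype κ] {A : Matrix ι ι ℂ} {c : ℝ}
    (hA : RowSumLE A c) (e : κ ↪ ι) : RowSumLE (A.submatrix e e) c := by
  intro x
  refine le_trans ?_ (hA (e x))
  have := Finset.sum_map Finset.univ e fun j => ‖A (e x) j‖
  simp only [Matrix.submatrix_apply]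
  rw [← this]
  exact Finset.sum_le_sum_of_subset_of_nonneg (Finset.subset_univ _) fun _ _ _ => norm_nonneg _

/-- The coordinate matrix of an embedding of index types. -/
def embMatrix {ι κ : Type*} [DecidableEq ι] (e : κ ↪ ι) : Matrix κ ι ℂ :=
  Matrix.of fun x i => if e x = i then 1 else 0

theorem rowSumLE_embMatrix {ι κ : Type*} [Fintype ι] [DecidableEq ι] (e : κ ↪ ι) :
    RowSumLE (embMatrix e) 1 := by
  intro x
  refine le_of_eq ?_
  rw [Finset.sum_eq_single (e x)] <;> simp +contextual [embMatrix, eq_comm]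

/-- Injectivity of `e` leaves at most one nonzero entry in each row of the transpose. -/
theorem rowSumLE_embMatrix_transpose {ι κ : Type*} [Fintype κ] [DecidableEq ι] (e : κ ↪ ι) :
    RowSumLE (embMatrix e).transpose 1 := by
  intro i
  by_cases h : ∃ x, e x = i
  · obtain ⟨x, rfl⟩ := h
    refine le_of_eq ?_
    rw [Finset.sum_eq_single x]
    · simp [embMatrix]
    · intro y _ hy
      simp [embMatrix, hy]
    · simp
  · push Not at h
    simp [embMatrix, h]

theorem embMatrix_mul_mul_transpose {ι κ : Type*} [Fintype ι] [DecidableEq ι] (e : κ ↪ ι)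
    (M : Matrix ι ι ℂ) :
    embMatrix e * M * (embMatrix e).transpose = M.submatrix e e := by
  ext x y
  simp [Matrix.mul_apply, embMatrix]

/-- The coordinate projection onto the complement of the range of an embedding. -/
def complProj {ι κ : Type*} [Fintype κ] [DecidableEq ι] (e : κ ↪ ι) : Matrix ι ι ℂ :=
  Matrix.diagonal fun i => if i ∈ Finset.univ.map e then 0 else 1

theorem transpose_mul_embMatrix {ι κ : Type*} [Fintype κ] [DecidableEq ι] (e : κ ↪ ι) :
    (embMatrix e).transpose * embMatrix e = 1 - complProj e := by
  ext i j
  simp only [Matrix.mul_apply, Matrix.transpose_apply, embMatrix, Matrix.of_apply,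
    Matrix.sub_apply, complProj, Matrix.one_apply, Matrix.diagonal_apply, Finset.mem_map,
    Finset.mem_univ, true_and]
  by_cases h : ∃ x, e x = i
  · obtain ⟨x, rfl⟩ := h
    rw [Finset.sum_eq_single x]
    · simp
    · intro y _ hy
      simp [hy]
    · simp
  · have h' : ∀ x, e x ≠ i := by simpa using h
    simp [h']

/-- The projection keeps only the diagonal entries outside the range of `e`, and each of them is
bounded by its row sum. -/
theorem norm_trace_complProj_mul_le {ι κ : Type*} [Fintype ι] [Fintype κ] [DecidableEq ι]
    (e : κ ↪ ι) {M : Matrix ι ι ℂ} {d : ℝ} (hM : RowSumLE M d) :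
    ‖(complProj e * M).trace‖ ≤ ((Fintype.card ι : ℝ) - Fintype.card κ) * d := by
  have h1 : (complProj e * M).trace = ∑ i ∈ (Finset.univ.map e)ᶜ, M i i := by
    simp only [Matrix.trace, Matrix.diag_apply, complProj, Matrix.diagonal_mul]
    rw [← Finset.sum_add_sum_compl (Finset.univ.map e)]
    rw [Finset.sum_eq_zero, zero_add]
    · refine Finset.sum_congr rfl fun i hi => ?_
      rw [Finset.mem_compl] at hi
      rw [if_neg hi, one_mul]
    · intro i hi
      rw [if_pos hi, zero_mul]
  have h2 : (((Finset.univ.map e)ᶜ.card : ℕ) : ℝ) = (Fintype.card ι : ℝ) - Fintype.card κ := by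
    rw [Finset.card_compl, Finset.card_map, Finset.card_univ,
      Nat.cast_sub (Fintype.card_le_of_embedding e)]
  rw [h1, ← h2, ← nsmul_eq_mul, ← Finset.sum_const]
  refine (norm_sum_le _ _).trans (Finset.sum_le_sum fun i _ => ?_)
  exact (Finset.single_le_sum (f := fun j => ‖M i j‖) (fun _ _ => norm_nonneg _)
    (Finset.mem_univ i)).trans (hM i)

/-- Compressing a power and taking the power of a compression differ by a telescoping sum of `k`
terms, each containing the projection onto the deleted indices. The free factor `B` makes the
induction close: the step from `k` to `k + 1` uses the hypothesis for `B * A`. -/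
theorem norm_trace_mul_submatrix_pow_sub_le {ι κ : Type*} [Fintype ι] [Fintype κ]
    [DecidableEq ι] [DecidableEq κ] (e : κ ↪ ι) {C : Matrix ι ι ℂ} {c : ℝ} (hc : 0 ≤ c)
    (hC : RowSumLE C c) (k : ℕ) : ∀ (B : Matrix κ κ ℂ) (d : ℝ), 0 ≤ d → RowSumLE B d →
    ‖(B * ((C ^ k).submatrix e e - (C.submatrix e e) ^ k)).trace‖ ≤
      k * ((Fintype.card ι : ℝ) - Fintype.card κ) * c ^ k * d := by
  induction k with
  | zero =>
    intro B d _ _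
    have : (1 : Matrix ι ι ℂ).submatrix e e = 1 := Matrix.submatrix_one_embedding e
    simp [this]
  | succ k ih =>
    intro B d hd hB
    set J := embMatrix e with hJ
    set A := C.submatrix e e with hA
    -- With `A = J C Jᵀ`, insert `1 = JᵀJ + complProj e` after the first factor `C` in `J C ^ (k +
    -- 1) Jᵀ`.
    have key : (C ^ (k + 1)).submatrix e e - A ^ (k + 1) =
        A * ((C ^ k).submatrix e e - A ^ k) +
          J * C * (complProj e * (C ^ k * J.transpose)) := by
      have h1 : complProj e = 1 - J.transpose * J := by
        rw [hJ, transpose_mul_embMatrix]; abel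
      rw [h1, hA, ← embMatrix_mul_mul_transpose, ← embMatrix_mul_mul_transpose,
        ← embMatrix_mul_mul_transpose, ← hJ, pow_succ' C, pow_succ' (J * C * J.transpose)]
      simp only [mul_sub, Matrix.mul_sub, Matrix.sub_mul, Matrix.mul_assoc,
        Matrix.one_mul]
      abel
    rw [key, mul_add, Matrix.trace_add]
    -- Cyclicity of the trace brings the projection to the front, where the trace bound applies.
    have e1 : (B * (J * C * (complProj e * (C ^ k * J.transpose)))).trace =
        (complProj e * (C ^ k * J.transpose * (B * (J * C)))).trace := by
      rw [← Matrix.mul_assoc, Matrix.trace_mul_comm]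
      simp only [Matrix.mul_assoc]
    have e2 : RowSumLE (C ^ k * J.transpose * (B * (J * C))) (c ^ k * 1 * (d * (1 * c))) :=
      ((hC.pow hc k).mul (rowSumLE_embMatrix_transpose e) zero_le_one).mul
        (hB.mul ((rowSumLE_embMatrix e).mul hC hc) (by positivity)) (by positivity)
    have e3 := norm_trace_complProj_mul_le e e2
    have e4 := ih (B * A) (d * c) (by positivity) (hB.mul (hC.submatrix e) hc)
    rw [e1, ← mul_assoc]
    refine (norm_add_le _ _).trans ((add_le_add e4 e3).trans (le_of_eq ?_))
    push_cast
    ring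

/-- The traces of the powers of a matrix and of a principal submatrix differ by at most a
multiple of the number of deleted rows. -/
theorem norm_trace_submatrix_pow_sub_le {ι κ : Type*} [Fintype ι] [Fintype κ]
    [DecidableEq ι] [DecidableEq κ] (e : κ ↪ ι) {C : Matrix ι ι ℂ} {c : ℝ} (hc : 0 ≤ c)
    (hC : RowSumLE C c) (k : ℕ) :
    ‖((C.submatrix e e) ^ k).trace - (C ^ k).trace‖ ≤
      (k + 1) * c ^ k * ((Fintype.card ι : ℝ) - Fintype.card κ) := by
  have h1 := norm_trace_mul_submatrix_pow_sub_le e hc hC k 1 1 zero_le_one rowSumLE_one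
  have h2 := norm_trace_complProj_mul_le e (hC.pow hc k)
  -- The diagonal entries of `C ^ k` lost in the compression; they account for the `1` in the factor
  -- `k + 1`.
  have h3 : (complProj e * C ^ k).trace = (C ^ k).trace - ((C ^ k).submatrix e e).trace := by
    have h4 : ((C ^ k).submatrix e e).trace = (C ^ k * (1 - complProj e)).trace := by
      rw [← embMatrix_mul_mul_transpose, Matrix.mul_assoc, Matrix.trace_mul_comm,
        Matrix.mul_assoc, transpose_mul_embMatrix]
    rw [h4, mul_sub, mul_one, Matrix.trace_sub, Matrix.trace_mul_comm (complProj e)]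
    ring
  rw [one_mul, Matrix.trace_sub] at h1
  rw [h3] at h2
  have h4 := norm_add_le (((C ^ k).submatrix e e).trace - ((C.submatrix e e) ^ k).trace)
    ((C ^ k).trace - ((C ^ k).submatrix e e).trace)
  rw [norm_sub_rev]
  calc _ = ‖((C ^ k).submatrix e e).trace - ((C.submatrix e e) ^ k).trace +
      ((C ^ k).trace - ((C ^ k).submatrix e e).trace)‖ := by congr 1; ring
    _ ≤ _ := h4.trans ((add_le_add h1 h2).trans (le_of_eq (by ring)))

/-! Bivariate trigonometric polynomials and their circulant matrices -/

/-- Bivariate trigonometric polynomials, as formal combinations of the characters. -/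
abbrev TrigPoly : Type := AddMonoidAlgebra ℂ (ℤ × ℤ)

/-- The character of index `m` of the torus at the point `θ`. -/
def torusChar (θ : ℝ × ℝ) (m : ℤ × ℤ) : ℂ :=
  Complex.exp (Complex.I * ((m.1 : ℂ) * θ.1 + (m.2 : ℂ) * θ.2))

/-- Evaluation of a trigonometric polynomial at a point. -/
def trigEval (θ : ℝ × ℝ) : TrigPoly →+* ℂ :=
  (AddMonoidAlgebra.lift ℂ ℂ (ℤ × ℤ)
    { toFun := fun m => torusChar θ m.toAdd
      map_one' := by simp [torusChar]
      map_mul' := fun m m' => by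
        simp only [torusChar, ← Complex.exp_add, toAdd_mul, Prod.fst_add, Prod.snd_add]
        push_cast
        congr 1
        ring }).toRingHom

theorem trigEval_apply (θ : ℝ × ℝ) (r : TrigPoly) :
    trigEval θ r = ∑ m ∈ r.coeff.support, r.coeff m * torusChar θ m := by
  simp [trigEval, AddMonoidAlgebra.lift_apply, Finsupp.sum]

/-- Reduction of a pair of integers modulo `n`. -/
def modPair (n : ℕ) : ℤ × ℤ →+ ZMod n × ZMod n :=
  (Int.castAddHom (ZMod n)).prodMap (Int.castAddHom (ZMod n))

theorem modPair_apply (n : ℕ) (m : ℤ × ℤ) : modPair n m = ((m.1 : ZMod n), (m.2 : ZMod n)) := rfl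

theorem modPair_eq_zero_iff {n : ℕ} {m : ℤ × ℤ} (h1 : |m.1| < n) (h2 : |m.2| < n) :
    modPair n m = 0 ↔ m = 0 := by
  constructor
  · intro h
    rw [modPair_apply, Prod.mk_eq_zero, ZMod.intCast_zmod_eq_zero_iff_dvd,
      ZMod.intCast_zmod_eq_zero_iff_dvd] at h
    exact Prod.ext (Int.eq_zero_of_abs_lt_dvd h.1 h1) (Int.eq_zero_of_abs_lt_dvd h.2 h2)
  · rintro rfl
    exact map_zero _

/-- The two-level circulant matrix of order `n` of a trigonometric polynomial. -/
def circulantHom (n : ℕ) [NeZero n] :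
    TrigPoly →+* Matrix (ZMod n × ZMod n) (ZMod n × ZMod n) ℂ :=
  (AddMonoidAlgebra.lift ℂ (Matrix (ZMod n × ZMod n) (ZMod n × ZMod n) ℂ) (ℤ × ℤ)
    { toFun := fun m => Matrix.of fun i j => if i = j + modPair n m.toAdd then 1 else 0
      map_one' := by
        ext i j
        simp [Matrix.one_apply]
      map_mul' := fun m m' => by
        ext i j
        simp only [Matrix.mul_apply, Matrix.of_apply, toAdd_mul, map_add, mul_ite, mul_one,
          mul_zero, Finset.sum_ite_eq', Finset.mem_univ, if_true, add_assoc]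
        simp [add_comm] }).toRingHom

theorem circulantHom_apply (n : ℕ) [NeZero n] (r : TrigPoly) (i j : ZMod n × ZMod n) :
    circulantHom n r i j =
      ∑ m ∈ r.coeff.support, r.coeff m * if i = j + modPair n m then 1 else 0 := by
  simp [circulantHom, AddMonoidAlgebra.lift_apply, Finsupp.sum, Matrix.sum_apply]

/-- A shift by `m` contributes to the diagonal only if `m` vanishes modulo `n`; for `n` above the
degree this forces `m = 0`. -/
theorem trace_circulantHom {n : ℕ} [NeZero n] {r : TrigPoly}
    (h : ∀ m ∈ r.coeff.support, |m.1| < n ∧ |m.2| < n) :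
    (circulantHom n r).trace = (n : ℂ) ^ 2 * r.coeff 0 := by
  have h1 : ∀ i, circulantHom n r i i = r.coeff 0 := by
    intro i
    rw [circulantHom_apply]
    have : ∀ m ∈ r.coeff.support,
        (r.coeff m * if i = i + modPair n m then (1 : ℂ) else 0) =
          if m = 0 then r.coeff 0 else 0 := by
      intro m hm
      simp only [left_eq_add, modPair_eq_zero_iff (h m hm).1 (h m hm).2]
      by_cases h0 : m = 0 <;> simp [h0]
    rw [Finset.sum_congr rfl this, Finset.sum_ite_eq']
    split_ifs with h0
    · rfl
    · exact (Finsupp.notMem_support_iff.mp h0).symm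
  simp [Matrix.trace, h1, ZMod.card, sq]

theorem sum_norm_circulantHom_le (n : ℕ) [NeZero n] (r : TrigPoly) (i : ZMod n × ZMod n) :
    ∑ j, ‖circulantHom n r i j‖ ≤ ∑ m ∈ r.coeff.support, ‖r.coeff m‖ := by
  calc ∑ j, ‖circulantHom n r i j‖
      ≤ ∑ j, ∑ m ∈ r.coeff.support, ‖r.coeff m‖ * if i = j + modPair n m then 1 else 0 := by
        refine Finset.sum_le_sum fun j _ => ?_
        rw [circulantHom_apply]
        refine (norm_sum_le _ _).trans (Finset.sum_le_sum fun m _ => ?_)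
        rw [norm_mul]
        split_ifs <;> simp
    _ = _ := by
        rw [Finset.sum_comm]
        refine Finset.sum_congr rfl fun m _ => ?_
        rw [← Finset.mul_sum, Finset.sum_eq_single (i - modPair n m)]
        · simp
        · intro j _ hj
          rw [if_neg]
          rintro rfl
          simp at hj
        · simp

/-- The reindexing by `m ↦ -m` behind both the pointwise and the circulant Hermitian symmetry. -/
theorem sum_coeff_mul_of_conj {r s : TrigPoly}
    (h : ∀ m, s.coeff m = star (r.coeff (-m))) (φ : ℤ × ℤ → ℂ) :
    ∑ m ∈ s.coeff.support, s.coeff m * φ m =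
      ∑ m ∈ r.coeff.support, star (r.coeff m) * φ (-m) := by
  refine Finset.sum_nbij' (fun m => -m) (fun m => -m) ?_ ?_ ?_ ?_ ?_
  · intro m hm
    rw [Finsupp.mem_support_iff, h] at hm
    simpa using hm
  · intro m hm
    rw [Finsupp.mem_support_iff] at hm ⊢
    rw [h]
    simpa using hm
  · simp
  · simp
  · intro m _
    simp [h]

theorem trigEval_of_conj {r s : TrigPoly} (h : ∀ m, s.coeff m = star (r.coeff (-m)))
    (θ : ℝ × ℝ) : trigEval θ s = star (trigEval θ r) := by
  rw [trigEval_apply, trigEval_apply, sum_coeff_mul_of_conj h, star_sum]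
  refine Finset.sum_congr rfl fun m _ => ?_
  rw [star_mul']
  congr 1
  simp only [torusChar, Complex.star_def, ← Complex.exp_conj]
  congr 1
  simp
  ring

theorem circulantHom_of_conj {r s : TrigPoly} (h : ∀ m, s.coeff m = star (r.coeff (-m)))
    (n : ℕ) [NeZero n] (i j : ZMod n × ZMod n) :
    circulantHom n s i j = star (circulantHom n r j i) := by
  rw [circulantHom_apply, circulantHom_apply, sum_coeff_mul_of_conj h, star_sum]
  refine Finset.sum_congr rfl fun m _ => ?_
  rw [star_mul']
  congr 1
  have : i = j + modPair n (-m) ↔ j = i + modPair n m := by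
    rw [map_neg, ← sub_eq_add_neg, eq_sub_iff_add_eq, eq_comm]
  simp only [this]
  split_ifs <;> simp

/-! ### Orthogonality of characters and Fourier coefficients -/

theorem integral_exp_I_mul_int (m : ℤ) :
    ∫ t in Icc (-Real.pi) Real.pi, Complex.exp (Complex.I * ((m : ℂ) * (t : ℂ))) =
      if m = 0 then 2 * (Real.pi : ℂ) else 0 := by
  rw [integral_Icc_eq_integral_Ioc, ← intervalIntegral.integral_of_le (by linarith [Real.pi_pos])]
  split_ifs with h
  · subst h
    simp
    ring
  · have hm : Complex.I * (m : ℂ) ≠ 0 := mul_ne_zero Complex.I_ne_zero (by exact_mod_cast h)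
    simp_rw [← mul_assoc]
    rw [integral_exp_mul_complex hm, div_eq_zero_iff]
    left
    rw [sub_eq_zero, Complex.exp_eq_exp_iff_exists_int]
    exact ⟨m, by push_cast; ring⟩

theorem integral_torusChar (m : ℤ × ℤ) :
    ∫ θ in torusSquare, torusChar θ m = if m = 0 then (2 * (Real.pi : ℂ)) ^ 2 else 0 := by
  have h1 : ∀ θ : ℝ × ℝ, torusChar θ m = Complex.exp (Complex.I * ((m.1 : ℂ) * (θ.1 : ℂ))) *
      Complex.exp (Complex.I * ((m.2 : ℂ) * (θ.2 : ℂ))) := by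
    intro θ
    rw [torusChar, mul_add, Complex.exp_add]
  simp_rw [h1]
  rw [torusSquare, Measure.volume_eq_prod, setIntegral_prod_mul
    (fun t : ℝ => Complex.exp (Complex.I * ((m.1 : ℂ) * (t : ℂ))))
    (fun t : ℝ => Complex.exp (Complex.I * ((m.2 : ℂ) * (t : ℂ)))),
    integral_exp_I_mul_int, integral_exp_I_mul_int]
  simp only [Prod.ext_iff, Prod.fst_zero, Prod.snd_zero]
  by_cases h2 : m.1 = 0 <;> by_cases h3 : m.2 = 0 <;> simp [h2, h3, sq]

theorem isCompact_torusSquare : IsCompact torusSquare := isCompact_Icc.prod isCompact_Icc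

theorem volume_real_torusSquare : volume.real torusSquare = (2 * Real.pi) ^ 2 := by
  rw [torusSquare, Measure.volume_eq_prod, measureReal_prod_prod, Real.volume_real_Icc_of_le
    (by linarith [Real.pi_pos])]
  ring

theorem continuous_torusChar (m : ℤ × ℤ) : Continuous fun θ => torusChar θ m := by
  unfold torusChar
  fun_prop

theorem continuous_trigEval (r : TrigPoly) : Continuous fun θ => trigEval θ r := by
  simp_rw [trigEval_apply]
  exact continuous_finsetSum _ fun m _ => continuous_const.mul (continuous_torusChar m)

theorem integral_trigEval_mul (r : TrigPoly) (k : ℤ × ℤ) :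
    ∫ θ in torusSquare, trigEval θ r *
      Complex.exp (-Complex.I * ((k.1 : ℂ) * θ.1 + (k.2 : ℂ) * θ.2)) =
      (2 * (Real.pi : ℂ)) ^ 2 * r.coeff k := by
  have h1 : ∀ θ : ℝ × ℝ, trigEval θ r *
      Complex.exp (-Complex.I * ((k.1 : ℂ) * θ.1 + (k.2 : ℂ) * θ.2)) =
      ∑ m ∈ r.coeff.support, r.coeff m * torusChar θ (m - k) := by
    intro θ
    rw [trigEval_apply, Finset.sum_mul]
    refine Finset.sum_congr rfl fun m _ => ?_
    rw [mul_assoc, torusChar, torusChar, ← Complex.exp_add]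
    simp only [Prod.fst_sub, Prod.snd_sub]
    push_cast
    congr 2
    ring
  simp_rw [h1]
  rw [integral_finsetSum]
  · simp_rw [integral_const_mul, integral_torusChar, sub_eq_zero, mul_ite, mul_zero,
      Finset.sum_ite_eq']
    split_ifs with h
    · ring
    · rw [Finsupp.notMem_support_iff.mp h, mul_zero]
  · intro m _
    exact (continuous_const.mul (continuous_torusChar _)).continuousOn.integrableOn_compact
      isCompact_torusSquare

theorem integral_trigEval (r : TrigPoly) :
    ∫ θ in torusSquare, trigEval θ r = (2 * (Real.pi : ℂ)) ^ 2 * r.coeff 0 := by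
  simpa using integral_trigEval_mul r 0

/-! Block Toeplitz matrices generated by matrix-valued trigonometric polynomials -/

/-- The matrix-valued function with trigonometric polynomial entries `F`. -/
def polySymbol {r : Type*} (F : Matrix r r TrigPoly) (θ : ℝ × ℝ) : Matrix r r ℂ :=
  F.map (trigEval θ)

/-- The block circulant matrix of order `n` of a matrix of trigonometric polynomials. -/
def blockCirculant {r : Type*} (n : ℕ) [NeZero n] (F : Matrix r r TrigPoly) :
    Matrix (r × (ZMod n × ZMod n)) (r × (ZMod n × ZMod n)) ℂ :=
  Matrix.comp r r _ _ ℂ (F.map (circulantHom n))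

theorem blockCirculant_apply {r : Type*} (n : ℕ) [NeZero n] (F : Matrix r r TrigPoly)
    (p q : r × (ZMod n × ZMod n)) :
    blockCirculant n F p q = circulantHom n (F p.1 q.1) p.2 q.2 := rfl

/-- The values of the matrix-valued trigonometric polynomial `F` are Hermitian matrices. -/
def IsHermitianSymbol {r : Type*} (F : Matrix r r TrigPoly) : Prop :=
  ∀ a b m, (F b a).coeff m = star ((F a b).coeff (-m))

/-- The sum of the moduli of all coefficients of all entries. -/
def coeffNorm {r : Type*} [Fintype r] (F : Matrix r r TrigPoly) : ℝ :=
  ∑ a, ∑ b, ∑ m ∈ (F a b).coeff.support, ‖(F a b).coeff m‖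

theorem coeffNorm_nonneg {r : Type*} [Fintype r] (F : Matrix r r TrigPoly) : 0 ≤ coeffNorm F :=
  Finset.sum_nonneg fun _ _ => Finset.sum_nonneg fun _ _ => Finset.sum_nonneg fun _ _ =>
    norm_nonneg _

theorem row_le_coeffNorm {r : Type*} [Fintype r] (F : Matrix r r TrigPoly) (a : r) :
    ∑ b, ∑ m ∈ (F a b).coeff.support, ‖(F a b).coeff m‖ ≤ coeffNorm F :=
  Finset.single_le_sum
    (f := fun a => ∑ b, ∑ m ∈ (F a b).coeff.support, ‖(F a b).coeff m‖)
    (fun _ _ => Finset.sum_nonneg fun _ _ => Finset.sum_nonneg fun _ _ => norm_nonneg _)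
    (Finset.mem_univ a)

theorem IsHermitianSymbol.polySymbol {r : Type*} {F : Matrix r r TrigPoly}
    (hF : IsHermitianSymbol F) (θ : ℝ × ℝ) : (polySymbol F θ).IsHermitian := by
  ext a b
  exact (trigEval_of_conj (hF b a) θ).symm

theorem IsHermitianSymbol.blockCirculant {r : Type*} {F : Matrix r r TrigPoly}
    (hF : IsHermitianSymbol F) (n : ℕ) [NeZero n] : (blockCirculant n F).IsHermitian := by
  ext p q
  exact (circulantHom_of_conj (hF q.1 p.1) n p.2 q.2).symm

theorem rowSumLE_polySymbol {r : Type*} [Fintype r] (F : Matrix r r TrigPoly) (θ : ℝ × ℝ) :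
    RowSumLE (polySymbol F θ) (coeffNorm F) := by
  intro a
  refine (Finset.sum_le_sum fun b _ => ?_).trans (row_le_coeffNorm F a)
  rw [polySymbol, Matrix.map_apply, trigEval_apply]
  refine (norm_sum_le _ _).trans (le_of_eq (Finset.sum_congr rfl fun m _ => ?_))
  have : ‖torusChar θ m‖ = 1 := by
    have h : Complex.I * ((m.1 : ℂ) * θ.1 + (m.2 : ℂ) * θ.2) =
        ((m.1 * θ.1 + m.2 * θ.2 : ℝ) : ℂ) * Complex.I := by
      push_cast; ring
    rw [torusChar, h, Complex.norm_exp_ofReal_mul_I]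
  rw [norm_mul, this, mul_one]

theorem rowSumLE_blockCirculant {r : Type*} [Fintype r] (F : Matrix r r TrigPoly) (n : ℕ)
    [NeZero n] : RowSumLE (blockCirculant n F) (coeffNorm F) := by
  rintro ⟨a, i⟩
  rw [Fintype.sum_prod_type]
  exact (Finset.sum_le_sum fun b _ => sum_norm_circulantHom_le n (F a b) i).trans
    (row_le_coeffNorm F a)

theorem continuous_polySymbol {r : Type*} (F : Matrix r r TrigPoly) :
    Continuous (polySymbol F) :=
  continuous_matrix fun a b => continuous_trigEval (F a b)

/-- Evaluation is a ring homomorphism, so powers and traces can be formed on the level of formal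
trigonometric polynomials. -/
theorem trace_polySymbol_pow {r : Type*} [Fintype r] [DecidableEq r] (F : Matrix r r TrigPoly)
    (θ : ℝ × ℝ) (k : ℕ) : (polySymbol F θ ^ k).trace = trigEval θ (F ^ k).trace := by
  have h : polySymbol F θ = (trigEval θ).mapMatrix F := rfl
  rw [h, ← map_pow, AddMonoidHom.map_trace]
  rfl

/-- The same reduction for circulants; flattening a matrix of blocks is a ring isomorphism, and the
trace is the trace of the sum of the diagonal blocks. -/
theorem trace_blockCirculant_pow {r : Type*} [Fintype r] [DecidableEq r] (n : ℕ) [NeZero n]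
    (F : Matrix r r TrigPoly) (k : ℕ) :
    (blockCirculant n F ^ k).trace = (circulantHom n (F ^ k).trace).trace := by
  have h : blockCirculant n F =
      Matrix.compRingEquiv r _ ℂ ((circulantHom n).mapMatrix F) := rfl
  rw [h, ← map_pow, ← map_pow, AddMonoidHom.map_trace, Matrix.trace, Fintype.sum_prod_type]
  simp only [Matrix.trace, Matrix.diag_apply, Matrix.sum_apply]
  exact Finset.sum_comm

theorem fourierCoeffMatrix_polySymbol {r : Type*} (F : Matrix r r TrigPoly) (k₁ k₂ : ℤ) (a b : r) :
    fourierCoeffMatrix (polySymbol F) k₁ k₂ a b = (F a b).coeff (k₁, k₂) := by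
  have h := integral_trigEval_mul (F a b) (k₁, k₂)
  simp only at h
  rw [fourierCoeffMatrix, Matrix.of_apply]
  simp only [polySymbol, Matrix.map_apply]
  rw [h, ← mul_assoc, one_div_mul_cancel, one_mul]
  exact pow_ne_zero _ (mul_ne_zero two_ne_zero (by exact_mod_cast Real.pi_ne_zero))

/-- The embedding of the indices of a Toeplitz matrix into those of a larger circulant. -/
def toeplitzEmb (r : Type*) {n N : ℕ} (h : n ≤ N) :
    (Fin n × Fin n) × r ↪ r × (ZMod N × ZMod N) where
  toFun p := (p.2, modPair N ((p.1.1 : ℕ), (p.1.2 : ℕ)))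
  inj' := by
    rintro ⟨⟨i, j⟩, a⟩ ⟨⟨i', j'⟩, a'⟩ hp
    have key : ∀ {x y : Fin n}, (((x : ℕ) : ℤ) : ZMod N) = (((y : ℕ) : ℤ) : ZMod N) → x = y := by
      intro x y hxy
      rw [Int.cast_natCast, Int.cast_natCast, ZMod.natCast_eq_natCast_iff] at hxy
      exact Fin.ext (hxy.eq_of_lt_of_lt (by omega) (by omega))
    simp only [Prod.mk.injEq, modPair_apply] at hp
    rw [hp.1, key hp.2.1, key hp.2.2]

theorem toeplitzEmb_apply {r : Type*} {n N : ℕ} (h : n ≤ N) (i j : Fin n) (a : r) :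
    toeplitzEmb r h ((i, j), a) = (a, modPair N (((i : ℕ) : ℤ), ((j : ℕ) : ℤ))) := rfl

/-- A banded block Toeplitz matrix is a principal submatrix of a circulant one. -/
theorem blockToeplitz_eq_submatrix {r : Type*} {F : Matrix r r TrigPoly} {w : ℕ}
    (hw : ∀ a b, ∀ m ∈ (F a b).coeff.support, |m.1| ≤ w ∧ |m.2| ≤ w) (n : ℕ) [NeZero (n + w)] :
    blockToeplitz n n (polySymbol F) = (blockCirculant (n + w) F).submatrix
      (toeplitzEmb r (Nat.le_add_right n w)) (toeplitzEmb r (Nat.le_add_right n w)) := by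
  ext ⟨⟨i, j⟩, a⟩ ⟨⟨i', j'⟩, b⟩
  simp only [blockToeplitz, Matrix.of_apply, fourierCoeffMatrix_polySymbol, Matrix.submatrix_apply,
    blockCirculant_apply, toeplitzEmb_apply, circulantHom_apply]
  set k : ℤ × ℤ := (((i : ℕ) : ℤ) - ((i' : ℕ) : ℤ), ((j : ℕ) : ℤ) - ((j' : ℕ) : ℤ)) with hk
  have : ∀ m ∈ (F a b).coeff.support, ((F a b).coeff m *
      if modPair (n + w) (((i : ℕ) : ℤ), ((j : ℕ) : ℤ)) =
        modPair (n + w) (((i' : ℕ) : ℤ), ((j' : ℕ) : ℤ)) + modPair (n + w) m then (1 : ℂ) else 0) =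
      if m = k then (F a b).coeff k else 0 := by
    intro m hm
    obtain ⟨h1, h2⟩ := hw a b m hm
    rw [abs_le] at h1 h2
    have hi := i.2
    have hi' := i'.2
    have hj := j.2
    have hj' := j'.2
    -- Both components of `i - i' - m` have modulus at most `n - 1 + w`, so the circulant of order
    -- `n + w` never wraps around on these indices.
    have e : modPair (n + w) (((i : ℕ) : ℤ), ((j : ℕ) : ℤ)) =
        modPair (n + w) (((i' : ℕ) : ℤ), ((j' : ℕ) : ℤ)) + modPair (n + w) m ↔ m = k := by
      rw [← map_add, ← sub_eq_zero, ← map_sub, modPair_eq_zero_iff]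
      · rw [hk, Prod.ext_iff, Prod.ext_iff]
        simp only [Prod.fst_sub, Prod.snd_sub, Prod.fst_add, Prod.snd_add, Prod.fst_zero,
          Prod.snd_zero]
        constructor <;> rintro ⟨g1, g2⟩ <;> constructor <;> omega
      · simp only [Prod.fst_sub, Prod.fst_add]
        rw [abs_lt]
        push_cast
        constructor <;> omega
      · simp only [Prod.snd_sub, Prod.snd_add]
        rw [abs_lt]
        push_cast
        constructor <;> omega
    simp only [e]
    by_cases h0 : m = k <;> simp [h0]
  rw [Finset.sum_congr rfl this, Finset.sum_ite_eq']
  split_ifs with h0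
  · rfl
  · exact Finsupp.notMem_support_iff.mp h0

/-- Principal submatrices of banded Hermitian block Toeplitz matrices in which asymptotically no
rows are lost have the spectral distribution described by the generating function. -/
theorem hasSpectralDistribution_submatrix_blockToeplitz {r : Type*} [Fintype r] [DecidableEq r]
    [Nonempty r] {F : Matrix r r TrigPoly} (hF : IsHermitianSymbol F) {κ : ℕ → Type*}
    [∀ n, Fintype (κ n)] [∀ n, DecidableEq (κ n)] (e : ∀ n, κ n ↪ (Fin n × Fin n) × r)
    (hκ : Tendsto (fun n => (Fintype.card (κ n) : ℝ) / (n : ℝ) ^ 2) atTop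
      (𝓝 (Fintype.card r))) :
    HasSpectralDistribution
      (fun n => (blockToeplitz n n (polySymbol F)).submatrix (e n) (e n))
      torusSquare (polySymbol F) := by
  -- A crude bound for the bandwidth; it is made positive so that `n + w` is nonzero also for `n =
  -- 0`.
  obtain ⟨w, hw0, hw⟩ : ∃ w : ℕ, 0 < w ∧
      ∀ a b, ∀ m ∈ (F a b).coeff.support, |m.1| ≤ w ∧ |m.2| ≤ w := by
    refine ⟨∑ a, ∑ b, ∑ m ∈ (F a b).coeff.support, (m.1.natAbs + m.2.natAbs) + 1, by omega,
      fun a b m hm => ?_⟩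
    have h1 := Finset.single_le_sum (f := fun m : ℤ × ℤ => m.1.natAbs + m.2.natAbs)
      (fun _ _ => Nat.zero_le _) hm
    have h2 := Finset.single_le_sum
      (f := fun b => ∑ m ∈ (F a b).coeff.support, (m.1.natAbs + m.2.natAbs))
      (fun _ _ => Nat.zero_le _) (Finset.mem_univ b)
    have h3 := Finset.single_le_sum
      (f := fun a => ∑ b, ∑ m ∈ (F a b).coeff.support, (m.1.natAbs + m.2.natAbs))
      (fun _ _ => Nat.zero_le _) (Finset.mem_univ a)
    rw [Int.abs_eq_natAbs, Int.abs_eq_natAbs]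
    constructor <;> omega
  have hne : ∀ n, NeZero (n + w) := fun n => ⟨by omega⟩
  set E : ∀ n, κ n ↪ r × (ZMod (n + w) × ZMod (n + w)) := fun n =>
    (e n).trans (toeplitzEmb r (Nat.le_add_right n w)) with hE
  have hsub : ∀ n, (blockToeplitz n n (polySymbol F)).submatrix (e n) (e n) =
      (blockCirculant (n + w) F).submatrix (E n) (E n) := by
    intro n
    rw [blockToeplitz_eq_submatrix hw, Matrix.submatrix_submatrix]
    rfl
  simp_rw [hsub]
  refine hasSpectralDistribution_of_moments isCompact_torusSquare ?_ (continuous_polySymbol F)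
    (c := coeffNorm F) (fun n => (hF.blockCirculant (n + w)).submatrix _)
    (fun n => (rowSumLE_blockCirculant F (n + w)).submatrix (E n)) hF.polySymbol
    (rowSumLE_polySymbol F) fun k => ?_
  · have h := volume_real_torusSquare
    have : volume.real torusSquare ≠ 0 := by rw [h]; positivity
    exact pos_iff_ne_zero.mpr fun h0 => this (by simp [measureReal_def, h0])
  set R : TrigPoly := (F ^ k).trace with hR
  have hs : (Fintype.card r : ℝ) ≠ 0 := by simp
  have hlim : (1 / (volume.real torusSquare : ℂ)) *
      ∫ θ in torusSquare, (polySymbol F θ ^ k).trace / (Fintype.card r : ℂ) =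
      ((((Fintype.card r : ℝ)⁻¹ : ℝ) : ℂ)) * R.coeff 0 := by
    simp_rw [trace_polySymbol_pow, ← hR]
    rw [integral_div, integral_trigEval, volume_real_torusSquare]
    have : (Real.pi : ℂ) ≠ 0 := by exact_mod_cast Real.pi_ne_zero
    have : (Fintype.card r : ℂ) ≠ 0 := by exact_mod_cast hs
    push_cast
    field_simp
  rw [hlim]
  have hratio : Tendsto (fun n : ℕ => ((n + w : ℕ) : ℝ) ^ 2 / (Fintype.card (κ n) : ℝ)) atTop
      (𝓝 (Fintype.card r : ℝ)⁻¹) := by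
    have h1 : Tendsto (fun n : ℕ => 1 + (w : ℝ) / (n : ℝ)) atTop (𝓝 (1 + 0)) :=
      (tendsto_const_div_atTop_nhds_zero_nat (w : ℝ)).const_add 1
    have h2 := (h1.pow 2).mul (hκ.inv₀ hs)
    simp only [add_zero, one_pow, one_mul] at h2
    refine h2.congr' ?_
    filter_upwards [eventually_gt_atTop 0] with n hn
    have : (n : ℝ) ≠ 0 := by positivity
    rw [inv_div]
    push_cast
    field_simp
  -- For large `n` the circulant moment equals `(n + w) ^ 2 / card (κ n)` times the constant
  -- coefficient of `R`.
  have hmain : Tendsto (fun n : ℕ => (1 / (Fintype.card (κ n) : ℂ)) *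
      (blockCirculant (n + w) F ^ k).trace) atTop
      (𝓝 ((((Fintype.card r : ℝ)⁻¹ : ℝ) : ℂ) * R.coeff 0)) := by
    have h1 := ((Complex.continuous_ofReal.tendsto _).comp hratio).mul_const (R.coeff 0)
    refine h1.congr' ?_
    have h2 : ∀ᶠ n : ℕ in atTop, ∀ m ∈ R.coeff.support,
        |m.1| < ((n + w : ℕ) : ℤ) ∧ |m.2| < ((n + w : ℕ) : ℤ) := by
      rw [eventually_all_finset]
      intro m _
      filter_upwards [eventually_gt_atTop (m.1.natAbs + m.2.natAbs)] with n hn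
      rw [Int.abs_eq_natAbs, Int.abs_eq_natAbs]
      constructor <;> omega
    filter_upwards [h2] with n hn
    rw [trace_blockCirculant_pow, ← hR, trace_circulantHom hn]
    simp only [Function.comp_apply]
    push_cast
    ring
  -- The number of deleted rows, `card r * (n + w) ^ 2 - card (κ n)`, is negligible compared with
  -- `card (κ n)`.
  have herr : Tendsto (fun n : ℕ => (1 / (Fintype.card (κ n) : ℂ)) *
      (((blockCirculant (n + w) F).submatrix (E n) (E n) ^ k).trace -
        (blockCirculant (n + w) F ^ k).trace)) atTop (𝓝 0) := by
    have h1 : Tendsto (fun n : ℕ => ((k : ℝ) + 1) * coeffNorm F ^ k *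
        ((Fintype.card r : ℝ) * (((n + w : ℕ) : ℝ) ^ 2 / (Fintype.card (κ n) : ℝ)) - 1)) atTop
        (𝓝 (((k : ℝ) + 1) * coeffNorm F ^ k *
          ((Fintype.card r : ℝ) * (Fintype.card r : ℝ)⁻¹ - 1))) :=
      ((hratio.const_mul _).sub_const 1).const_mul _
    rw [mul_inv_cancel₀ hs, sub_self, mul_zero] at h1
    refine squeeze_zero_norm' ?_ h1
    have hpos : ∀ᶠ n in atTop, 0 < (Fintype.card (κ n) : ℝ) / (n : ℝ) ^ 2 :=
      hκ.eventually (lt_mem_nhds (by positivity))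
    filter_upwards [hpos] with n hn
    have hk0 : (Fintype.card (κ n) : ℝ) ≠ 0 := by
      intro h0
      simp [h0] at hn
    have h2 := norm_trace_submatrix_pow_sub_le (E n) (coeffNorm_nonneg F)
      (rowSumLE_blockCirculant F (n + w)) k
    have hcard : (Fintype.card (r × (ZMod (n + w) × ZMod (n + w))) : ℝ) =
        (Fintype.card r : ℝ) * ((n + w : ℕ) : ℝ) ^ 2 := by
      simp only [Fintype.card_prod, ZMod.card]
      push_cast
      ring
    rw [hcard] at h2
    rw [norm_mul]
    refine (mul_le_mul_of_nonneg_left h2 (norm_nonneg _)).trans (le_of_eq ?_)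
    rw [norm_div, norm_one, Complex.norm_natCast]
    field_simp
  have := hmain.add herr
  rw [add_zero] at this
  refine this.congr fun n => ?_
  ring

theorem hasSpectralDistribution_blockToeplitz {r : Type*} [Fintype r] [DecidableEq r]
    [Nonempty r] {F : Matrix r r TrigPoly} (hF : IsHermitianSymbol F) :
    HasSpectralDistribution (fun n => blockToeplitz n n (polySymbol F))
      torusSquare (polySymbol F) := by
  refine hasSpectralDistribution_submatrix_blockToeplitz hF
    (fun n => Function.Embedding.refl _) ?_
  refine tendsto_const_nhds.congr' ?_
  filter_upwards [eventually_gt_atTop 0] with n hn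
  have : (n : ℝ) ≠ 0 := by positivity
  simp only [Fintype.card_prod, Fintype.card_fin]
  push_cast
  field_simp

/-! The symbol of the quadratic elements and its Fourier coefficients -/

/-- The unit mass at `0`. -/
def intDelta (k : ℤ) : ℤ := if k = 0 then 1 else 0

/-- The Fourier coefficients of the symbol of the quadratic elements, multiplied by `24`. -/
def p2Stencil (a b : Fin 4) (m₁ m₂ : ℤ) : ℤ :=
  !![128 * intDelta m₁ * intDelta m₂, -32 * (intDelta m₁ + intDelta (m₁ - 1)) * intDelta m₂,
      -32 * intDelta m₁ * (intDelta m₂ + intDelta (m₂ - 1)), 0;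
    -32 * (intDelta m₁ + intDelta (m₁ + 1)) * intDelta m₂, 128 * intDelta m₁ * intDelta m₂, 0,
      -32 * intDelta m₁ * (intDelta m₂ + intDelta (m₂ - 1));
    -32 * intDelta m₁ * (intDelta m₂ + intDelta (m₂ + 1)), 0, 128 * intDelta m₁ * intDelta m₂,
      -32 * (intDelta m₁ + intDelta (m₁ - 1)) * intDelta m₂;
    0, -32 * intDelta m₁ * (intDelta m₂ + intDelta (m₂ + 1)),
      -32 * (intDelta m₁ + intDelta (m₁ + 1)) * intDelta m₂,
      96 * intDelta m₁ * intDelta m₂ +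
        8 * ((intDelta (m₁ - 1) + intDelta (m₁ + 1)) * intDelta m₂ +
          intDelta m₁ * (intDelta (m₂ - 1) + intDelta (m₂ + 1)))] a b

/-- The indices of the possibly nonzero Fourier coefficients. -/
def p2Box : Finset (ℤ × ℤ) := {-1, 0, 1} ×ˢ {-1, 0, 1}

theorem mem_p2Box {m : ℤ × ℤ} : m ∈ p2Box ↔ (|m.1| ≤ 1 ∧ |m.2| ≤ 1) := by
  simp only [p2Box, Finset.mem_product, Finset.mem_insert, Finset.mem_singleton, abs_le]
  omega

theorem intDelta_of_ne {k : ℤ} (h : k ≠ 0) : intDelta k = 0 := if_neg h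

theorem p2Stencil_eq_zero (a b : Fin 4) {m : ℤ × ℤ} (h : ¬ (|m.1| ≤ 1 ∧ |m.2| ≤ 1)) :
    p2Stencil a b m.1 m.2 = 0 := by
  rw [abs_le, abs_le] at h
  have h' : (m.1 ≠ 0 ∧ m.1 - 1 ≠ 0 ∧ m.1 + 1 ≠ 0) ∨ (m.2 ≠ 0 ∧ m.2 - 1 ≠ 0 ∧ m.2 + 1 ≠ 0) := by
    omega
  rcases h' with ⟨h1, h2, h3⟩ | ⟨h1, h2, h3⟩ <;> fin_cases a <;> fin_cases b <;>
    simp [p2Stencil, intDelta_of_ne h1, intDelta_of_ne h2, intDelta_of_ne h3]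

/-- Scaling by 24 makes the coefficients integers, so the symmetry can be decided on the nine
relevant frequencies. -/
theorem p2Stencil_neg (a b : Fin 4) (m : ℤ × ℤ) :
    p2Stencil b a m.1 m.2 = p2Stencil a b (-m.1) (-m.2) := by
  by_cases h : |m.1| ≤ 1 ∧ |m.2| ≤ 1
  · have key : ∀ a b : Fin 4, ∀ m ∈ p2Box, p2Stencil b a m.1 m.2 =
      p2Stencil a b (-m.1) (-m.2) := by decide
    exact key a b m (mem_p2Box.mpr h)
  · rw [p2Stencil_eq_zero b a h]
    exact (p2Stencil_eq_zero a b (m := -m) (by simpa using h)).symm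

/-- The symbol of the quadratic elements as a matrix of formal trigonometric polynomials. -/
def p2Poly : Matrix (Fin 4) (Fin 4) TrigPoly := Matrix.of fun a b =>
  ∑ m ∈ p2Box, AddMonoidAlgebra.single m ((p2Stencil a b m.1 m.2 : ℂ) / 24)

theorem coeff_p2Poly (a b : Fin 4) (m : ℤ × ℤ) :
    (p2Poly a b).coeff m = (p2Stencil a b m.1 m.2 : ℂ) / 24 := by
  simp only [p2Poly, Matrix.of_apply, AddMonoidAlgebra.coeff_sum, Finsupp.finsetSum_apply,
    AddMonoidAlgebra.coeff_single, Finsupp.single_apply, Finset.sum_ite_eq']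
  split_ifs with h
  · rfl
  · rw [p2Stencil_eq_zero a b (fun h' => h (mem_p2Box.mpr h'))]
    simp

theorem isHermitianSymbol_p2Poly : IsHermitianSymbol p2Poly := by
  intro a b m
  rw [coeff_p2Poly, coeff_p2Poly, p2Stencil_neg]
  simp

theorem trigEval_single (θ : ℝ × ℝ) (m : ℤ × ℤ) (c : ℂ) :
    trigEval θ (AddMonoidAlgebra.single m c) = c * torusChar θ m := by
  simp [trigEval]

theorem symbolP2_eq_polySymbol : symbolP2 = polySymbol p2Poly := by
  funext θ
  have hc : ∀ t : ℝ, Complex.cos t =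
      (Complex.exp (Complex.I * t) + Complex.exp (-Complex.I * t)) / 2 := by
    intro t
    rw [Complex.cos]
    ring_nf
  have h1 : torusChar θ (0, 0) = 1 := by simp [torusChar]
  have h2 : torusChar θ (1, 0) = Complex.exp (Complex.I * θ.1) := by simp [torusChar]
  have h3 : torusChar θ (-1, 0) = Complex.exp (-Complex.I * θ.1) := by simp [torusChar]
  have h4 : torusChar θ (0, 1) = Complex.exp (Complex.I * θ.2) := by simp [torusChar]
  have h5 : torusChar θ (0, -1) = Complex.exp (-Complex.I * θ.2) := by simp [torusChar]
  ext a b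
  simp only [symbolP2, polySymbol, Matrix.map_apply, p2Poly, Matrix.of_apply, map_sum,
    trigEval_single, p2Box, Finset.sum_product, hc]
  fin_cases a <;> fin_cases b <;>
    simp [p2Stencil, intDelta, h1, h2, h3, h4, h5] <;> ring

/-! Local stiffness matrices -/

/-- The coefficients, in the basis `1, u, v, u², uv, v²`, of the quadratic shape function of the
node `(a / 2, b / 2)` of the reference triangle (zero if this is not a node). -/
def shapeCoeff (a b : ℤ) : Fin 6 → ℤ :=
  if a = 0 ∧ b = 0 then ![1, -3, -3, 2, 4, 2]
  else if a = 2 ∧ b = 0 then ![0, -1, 0, 2, 0, 0]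
  else if a = 0 ∧ b = 2 then ![0, 0, -1, 0, 0, 2]
  else if a = 1 ∧ b = 0 then ![0, 4, 0, -4, -4, 0]
  else if a = 0 ∧ b = 1 then ![0, 0, 4, 0, -4, -4]
  else if a = 1 ∧ b = 1 then ![0, 0, 0, 0, 4, 0]
  else 0

theorem shapeCoeff_eq_zero {a b : ℤ} (h : a < 0 ∨ 2 < a ∨ b < 0 ∨ 2 < b) :
    shapeCoeff a b = 0 := by
  unfold shapeCoeff
  split_ifs <;> first | omega | rfl

/-- `24` times the integral over the reference triangle of the product of two affine functions. -/
def affineGram (c d e c' d' e' : ℤ) : ℤ :=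
  12 * c * c' + 4 * (c * d' + d * c' + c * e' + e * c') + 2 * (d * d' + e * e') +
    (d * e' + e * d')

/-- `24` times the Dirichlet form of two quadratic polynomials on the reference triangle. -/
def quadDirichlet (q q' : Fin 6 → ℤ) : ℤ :=
  affineGram (q 1) (2 * q 3) (q 4) (q' 1) (2 * q' 3) (q' 4) +
    affineGram (q 2) (q 4) (2 * q 5) (q' 2) (q' 4) (2 * q' 5)

/-- `24` times the local stiffness matrix of the reference triangle. -/
def localStiffness (a b a' b' : ℤ) : ℤ := quadDirichlet (shapeCoeff a b) (shapeCoeff a' b')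

theorem localStiffness_eq_zero_left {a b : ℤ} (a' b' : ℤ)
    (h : a < 0 ∨ 2 < a ∨ b < 0 ∨ 2 < b) : localStiffness a b a' b' = 0 := by
  simp [localStiffness, shapeCoeff_eq_zero h, quadDirichlet, affineGram]

theorem localStiffness_eq_zero_right {a' b' : ℤ} (a b : ℤ)
    (h : a' < 0 ∨ 2 < a' ∨ b' < 0 ∨ 2 < b') : localStiffness a b a' b' = 0 := by
  simp [localStiffness, shapeCoeff_eq_zero h, quadDirichlet, affineGram]

/-- The contributions to a stiffness matrix entry of the two triangles of a mesh cell, in terms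
of the positions of the two nodes relative to the cell. -/
def cellStiffness (a b a' b' : ℤ) : ℤ :=
  localStiffness a b a' b' + localStiffness (2 - a) (2 - b) (2 - a') (2 - b')

theorem cellStiffness_eq_zero_left {a b : ℤ} (a' b' : ℤ)
    (h : a < 0 ∨ 2 < a ∨ b < 0 ∨ 2 < b) : cellStiffness a b a' b' = 0 := by
  rw [cellStiffness, localStiffness_eq_zero_left _ _ h,
    localStiffness_eq_zero_left _ _ (by omega), add_zero]

theorem cellStiffness_eq_zero_right {a' b' : ℤ} (a b : ℤ)
    (h : a' < 0 ∨ 2 < a' ∨ b' < 0 ∨ 2 < b') : cellStiffness a b a' b' = 0 := by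
  rw [cellStiffness, localStiffness_eq_zero_right _ _ h,
    localStiffness_eq_zero_right _ _ (by omega), add_zero]

/-- The component of a node in its block, according to the parities of its coordinates. -/
def parityIndex (x y : Fin 2) : Fin 4 := ⟨x + 2 * y, by omega⟩

set_option maxRecDepth 10000 in
-- Lengths are in units of half the mesh width. A node of parity `x` in block `I` has coordinate `2I
-- + x + 1`: for `x = 0` it is interior to cell column `I`, for `x = 1` it lies on the line between
-- columns `I` and `I + 1`. Hence the `x + 1` values of `s`, and the position `1 + x - 2s` relative
-- to column `I + s`. The second node lies `m` blocks behind the first.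
theorem sum_cellStiffness_of_mem : ∀ x y x' y' : Fin 2, ∀ m ∈ p2Box,
    ∑ s ∈ Finset.range ((x : ℕ) + 1), ∑ t ∈ Finset.range ((y : ℕ) + 1),
      cellStiffness (1 + ((x : ℕ) : ℤ) - 2 * (s : ℤ)) (1 + ((y : ℕ) : ℤ) - 2 * (t : ℤ))
        (1 + ((x' : ℕ) : ℤ) - 2 * (s : ℤ) - 2 * m.1) (1 + ((y' : ℕ) : ℤ) - 2 * (t : ℤ) - 2 * m.2) =
      p2Stencil (parityIndex x y) (parityIndex x' y') m.1 m.2 := by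
  decide +kernel

theorem sum_cellStiffness (x y x' y' : Fin 2) (m : ℤ × ℤ) :
    ∑ s ∈ Finset.range ((x : ℕ) + 1), ∑ t ∈ Finset.range ((y : ℕ) + 1),
      cellStiffness (1 + ((x : ℕ) : ℤ) - 2 * (s : ℤ)) (1 + ((y : ℕ) : ℤ) - 2 * (t : ℤ))
        (1 + ((x' : ℕ) : ℤ) - 2 * (s : ℤ) - 2 * m.1) (1 + ((y' : ℕ) : ℤ) - 2 * (t : ℤ) - 2 * m.2) =
      p2Stencil (parityIndex x y) (parityIndex x' y') m.1 m.2 := by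
  by_cases h : |m.1| ≤ 1 ∧ |m.2| ≤ 1
  · exact sum_cellStiffness_of_mem x y x' y' m (mem_p2Box.mpr h)
  · rw [p2Stencil_eq_zero _ _ h]
    refine Finset.sum_eq_zero fun s hs => Finset.sum_eq_zero fun t ht => ?_
    rw [Finset.mem_range] at hs ht
    rw [abs_le, abs_le] at h
    -- When the blocks differ by more than one in some direction, the second node lies outside every
    -- cell meeting the first.
    exact cellStiffness_eq_zero_right _ _ (by omega)

/-! Quadratic interpolation on the triangles of the mesh -/

/-- The quadratic polynomial with given coefficients in the basis `1, u, v, u², uv, v²`. -/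
def quadPoly (q : Fin 6 → ℝ) (u v : ℝ) : ℝ :=
  q 0 + q 1 * u + q 2 * v + q 3 * u ^ 2 + q 4 * (u * v) + q 5 * v ^ 2

theorem exists_quadPoly_of_totalDegree_le {p : MvPolynomial (Fin 2) ℝ} (hp : p.totalDegree ≤ 2) :
    ∃ q : Fin 6 → ℝ, ∀ x y : ℝ, MvPolynomial.eval ![x, y] p = quadPoly q x y := by
  have hmono : ∀ d ∈ p.support, ∃ q : Fin 6 → ℝ, ∀ x y : ℝ,
      p.coeff d * ∏ i, ![x, y] i ^ d i = quadPoly q x y := by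
    intro d hd
    have h1 : d 0 + d 1 ≤ 2 := by
      have := (MvPolynomial.le_totalDegree hd).trans hp
      rw [Finsupp.sum_fintype _ _ (by simp)] at this
      simpa [Fin.sum_univ_two] using this
    have h2 : (d 0 = 0 ∧ d 1 = 0) ∨ (d 0 = 1 ∧ d 1 = 0) ∨ (d 0 = 0 ∧ d 1 = 1) ∨
        (d 0 = 2 ∧ d 1 = 0) ∨ (d 0 = 1 ∧ d 1 = 1) ∨ (d 0 = 0 ∧ d 1 = 2) := by omega
    rcases h2 with h | h | h | h | h | h
    · exact ⟨![p.coeff d, 0, 0, 0, 0, 0], fun x y => by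
        simp [Fin.prod_univ_two, h.1, h.2, quadPoly]⟩
    · exact ⟨![0, p.coeff d, 0, 0, 0, 0], fun x y => by
        simp [Fin.prod_univ_two, h.1, h.2, quadPoly]⟩
    · exact ⟨![0, 0, p.coeff d, 0, 0, 0], fun x y => by
        simp [Fin.prod_univ_two, h.1, h.2, quadPoly]⟩
    · exact ⟨![0, 0, 0, p.coeff d, 0, 0], fun x y => by
        simp [Fin.prod_univ_two, h.1, h.2, quadPoly]⟩
    · exact ⟨![0, 0, 0, 0, p.coeff d, 0], fun x y => by
        simp [Fin.prod_univ_two, h.1, h.2, quadPoly]⟩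
    · exact ⟨![0, 0, 0, 0, 0, p.coeff d], fun x y => by
        simp [Fin.prod_univ_two, h.1, h.2, quadPoly]⟩
  choose! q hq using hmono
  refine ⟨∑ d ∈ p.support, q d, fun x y => ?_⟩
  rw [MvPolynomial.eval_eq', Finset.sum_congr rfl fun d hd => hq d hd x y]
  simp only [quadPoly, Finset.sum_add_distrib, Finset.sum_apply, Finset.sum_mul]

/-- The new coefficients come from the Taylor expansion at `(α, β)`, scaled by powers of `τ`. -/
theorem quadPoly_comp_affine (q : Fin 6 → ℝ) (α β τ : ℝ) :
    ∃ q' : Fin 6 → ℝ, ∀ u v : ℝ, quadPoly q (α + τ * u) (β + τ * v) = quadPoly q' u v := by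
  refine ⟨![quadPoly q α β, τ * (q 1 + 2 * q 3 * α + q 4 * β),
    τ * (q 2 + q 4 * α + 2 * q 5 * β), τ ^ 2 * q 3, τ ^ 2 * q 4, τ ^ 2 * q 5], fun u v => ?_⟩
  simp only [quadPoly, Matrix.cons_val]
  ring

/-- The indices of the nodes of the reference triangle. -/
def IsRefNode (a b : ℤ) : Prop := 0 ≤ a ∧ 0 ≤ b ∧ a + b ≤ 2

theorem isRefNode_iff {a b : ℤ} : IsRefNode a b ↔ (a = 0 ∧ b = 0) ∨ (a = 2 ∧ b = 0) ∨
    (a = 0 ∧ b = 2) ∨ (a = 1 ∧ b = 0) ∨ (a = 0 ∧ b = 1) ∨ (a = 1 ∧ b = 1) := by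
  unfold IsRefNode
  omega

/-- A quadratic polynomial is determined by its values at the nodes of the reference triangle. -/
theorem quadPoly_eq_shape {q : Fin 6 → ℝ} {a₀ b₀ : ℤ}
    (h : ∀ a b : ℤ, IsRefNode a b → quadPoly q ((a : ℝ) / 2) ((b : ℝ) / 2) =
      if a = a₀ ∧ b = b₀ then 1 else 0) (u v : ℝ) :
    quadPoly q u v = quadPoly (fun i => (shapeCoeff a₀ b₀ i : ℝ)) u v := by
  have h00 := h 0 0 (by norm_num [IsRefNode])
  have h20 := h 2 0 (by norm_num [IsRefNode])
  have h02 := h 0 2 (by norm_num [IsRefNode])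
  have h10 := h 1 0 (by norm_num [IsRefNode])
  have h01 := h 0 1 (by norm_num [IsRefNode])
  have h11 := h 1 1 (by norm_num [IsRefNode])
  -- Lagrange interpolation: the right-hand factors are the six quadratic shape functions.
  have key : quadPoly q u v =
      quadPoly q ((0 : ℤ) / 2) ((0 : ℤ) / 2) * ((1 - u - v) * (1 - 2 * u - 2 * v)) +
      quadPoly q ((2 : ℤ) / 2) ((0 : ℤ) / 2) * (2 * u ^ 2 - u) +
      quadPoly q ((0 : ℤ) / 2) ((2 : ℤ) / 2) * (2 * v ^ 2 - v) +
      quadPoly q ((1 : ℤ) / 2) ((0 : ℤ) / 2) * (4 * u * (1 - u - v)) +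
      quadPoly q ((0 : ℤ) / 2) ((1 : ℤ) / 2) * (4 * v * (1 - u - v)) +
      quadPoly q ((1 : ℤ) / 2) ((1 : ℤ) / 2) * (4 * u * v) := by
    simp only [quadPoly]
    push_cast
    ring
  rw [key, h00, h20, h02, h10, h01, h11]
  by_cases hn : IsRefNode a₀ b₀
  · rcases isRefNode_iff.mp hn with ⟨rfl, rfl⟩ | ⟨rfl, rfl⟩ | ⟨rfl, rfl⟩ | ⟨rfl, rfl⟩ |
      ⟨rfl, rfl⟩ | ⟨rfl, rfl⟩ <;>
      simp [shapeCoeff, quadPoly] <;> ring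
  · have h0 : ∀ a b : ℤ, IsRefNode a b → ¬ (a = a₀ ∧ b = b₀) := by
      rintro a b hab ⟨rfl, rfl⟩
      exact hn hab
    have hz : shapeCoeff a₀ b₀ = 0 := by
      rw [isRefNode_iff] at hn
      unfold shapeCoeff
      split_ifs <;> first | rfl | (exfalso; omega)
    rw [if_neg (h0 _ _ (by norm_num [IsRefNode])), if_neg (h0 _ _ (by norm_num [IsRefNode])),
      if_neg (h0 _ _ (by norm_num [IsRefNode])), if_neg (h0 _ _ (by norm_num [IsRefNode])),
      if_neg (h0 _ _ (by norm_num [IsRefNode])), if_neg (h0 _ _ (by norm_num [IsRefNode])), hz]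
    simp [quadPoly]

theorem combo_mem_of_convex {s : Set (ℝ × ℝ)} (hs : Convex ℝ s) {P Q R : ℝ × ℝ} (hP : P ∈ s)
    (hQ : Q ∈ s) (hR : R ∈ s) {a b c : ℝ} (ha : 0 ≤ a) (hb : 0 ≤ b) (hc : 0 ≤ c)
    (habc : a + b + c = 1) : a • P + b • Q + c • R ∈ s := by
  have := hs.sum_mem (t := Finset.univ) (w := ![a, b, c]) (z := ![P, Q, R])
    (by simp [Fin.forall_fin_succ, ha, hb, hc]) (by simp [Fin.sum_univ_three, habc])
    (by simp [Fin.forall_fin_succ, hP, hQ, hR])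
  simpa [Fin.sum_univ_three] using this

theorem mem_lowerTriangle {N : ℕ} (i j : ℕ) {u v : ℝ} (hu : 0 ≤ u) (hv : 0 ≤ v)
    (huv : u + v ≤ 1) : (((i : ℝ) + u) / N, ((j : ℝ) + v) / N) ∈ lowerTriangle N i j := by
  have h := combo_mem_of_convex (convex_convexHull ℝ _)
    (subset_convexHull ℝ ({((i : ℝ) / N, (j : ℝ) / N), (((i : ℝ) + 1) / N, (j : ℝ) / N),
      ((i : ℝ) / N, ((j : ℝ) + 1) / N)} : Set (ℝ × ℝ)) (by simp : ((i : ℝ) / N, (j : ℝ) / N) ∈ _))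
    (subset_convexHull ℝ _ (by simp : (((i : ℝ) + 1) / N, (j : ℝ) / N) ∈ _))
    (subset_convexHull ℝ _ (by simp : ((i : ℝ) / N, ((j : ℝ) + 1) / N) ∈ _))
    (by linarith : 0 ≤ 1 - u - v) hu hv (by ring)
  refine Eq.mp (congrArg (· ∈ lowerTriangle N i j) ?_) h
  ext <;> simp <;> ring

theorem mem_upperTriangle {N : ℕ} (i j : ℕ) {u v : ℝ} (hu : 0 ≤ u) (hv : 0 ≤ v)
    (huv : u + v ≤ 1) :
    (((i : ℝ) + 1 - u) / N, ((j : ℝ) + 1 - v) / N) ∈ upperTriangle N i j := by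
  have h := combo_mem_of_convex (convex_convexHull ℝ _)
    (subset_convexHull ℝ ({(((i : ℝ) + 1) / N, (j : ℝ) / N),
      (((i : ℝ) + 1) / N, ((j : ℝ) + 1) / N), ((i : ℝ) / N, ((j : ℝ) + 1) / N)} : Set (ℝ × ℝ))
      (by simp : (((i : ℝ) + 1) / N, (j : ℝ) / N) ∈ _))
    (subset_convexHull ℝ _ (by simp : (((i : ℝ) + 1) / N, ((j : ℝ) + 1) / N) ∈ _))
    (subset_convexHull ℝ _ (by simp : ((i : ℝ) / N, ((j : ℝ) + 1) / N) ∈ _))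
    hv (by linarith : 0 ≤ 1 - u - v) hu (by ring)
  refine Eq.mp (congrArg (· ∈ upperTriangle N i j) ?_) h
  ext <;> simp <;> ring

theorem nodalBasis_mem {N : ℕ} (m : P2Node N) : nodalBasis m ∈ femSpace 2 N :=
  (exists_nodalFun m).choose_spec.1

theorem nodalBasis_pos {N : ℕ} (m m' : P2Node N) :
    nodalBasis m m'.pos = if m' = m then 1 else 0 :=
  (exists_nodalFun m).choose_spec.2 m'

/-- The values of a nodal basis function at all the nodes, including those on the boundary. -/
theorem nodalBasis_node {N : ℕ} (m : P2Node N) {k l : ℤ} (hk : 0 ≤ k) (hk' : k ≤ 2 * N)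
    (hl : 0 ≤ l) (hl' : l ≤ 2 * N) :
    nodalBasis m ((k : ℝ) / (2 * N), (l : ℝ) / (2 * N)) =
      if k = (m.1 : ℕ) + 1 ∧ l = (m.2 : ℕ) + 1 then 1 else 0 := by
  have hm1 := m.1.2
  have hm2 := m.2.2
  have hN : 0 < N := by omega
  have hN' : (0 : ℝ) < 2 * N := by positivity
  by_cases hint : 0 < k ∧ k < 2 * N ∧ 0 < l ∧ l < 2 * N
  · obtain ⟨h1, h2, h3, h4⟩ := hint
    have h := nodalBasis_pos m (⟨(k - 1).toNat, by omega⟩, ⟨(l - 1).toNat, by omega⟩)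
    have e : ∀ z : ℤ, 0 < z → (((z - 1).toNat : ℕ) : ℝ) + 1 = z := by
      intro z hz
      have : (((z - 1).toNat : ℕ) : ℤ) = z - 1 := Int.toNat_of_nonneg (by omega)
      have h' : (((z - 1).toNat : ℕ) : ℝ) = (((z - 1).toNat : ℤ) : ℝ) := rfl
      rw [h', this]
      push_cast
      ring
    simp only [P2Node.pos, e k h1, e l h3] at h
    rw [h]
    refine if_congr ?_ rfl rfl
    rw [Prod.ext_iff, Fin.ext_iff, Fin.ext_iff]
    simp only
    omega
  · rw [if_neg (by omega)]
    refine (nodalBasis_mem m).2.2 _ ?_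
    rw [unitSquare, frontier_prod_eq, frontier_Ioo zero_lt_one, closure_Ioo zero_ne_one]
    have hb : ∀ z : ℤ, 0 ≤ z → z ≤ 2 * N → (z : ℝ) / (2 * N) ∈ Icc (0 : ℝ) 1 := by
      intro z h0 h1
      have h0' : (0 : ℝ) ≤ z := by exact_mod_cast h0
      have h1' : (z : ℝ) ≤ 2 * N := by exact_mod_cast h1
      exact ⟨by positivity, (div_le_one hN').mpr h1'⟩
    have he : ∀ z : ℤ, z = 0 ∨ z = 2 * N → (z : ℝ) / (2 * N) ∈ ({0, 1} : Set ℝ) := by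
      rintro z (rfl | rfl)
      · simp
      · right
        push_cast
        exact div_self hN'.ne'
    have : (k = 0 ∨ k = 2 * N) ∨ (l = 0 ∨ l = 2 * N) := by omega
    rcases this with h | h
    · exact Or.inr ⟨he k h, hb l hl hl'⟩
    · exact Or.inl ⟨hb k hk hk', he l h⟩

/-- The basis functions are chosen from an existence statement, so their form has to be recovered.
Pulled back to the reference triangle, such a function is a quadratic polynomial with known values
at six nodes, hence a shape function or zero. The sign `σ = -1` covers upper triangles, which are
point reflections of lower ones. -/
theorem nodalBasis_eq_shape {N : ℕ} (m : P2Node N) {K : Set (ℝ × ℝ)}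
    (hK : K ∈ friedrichsKeller N) {σ B₁ B₂ : ℤ} (hσ : σ = 1 ∨ σ = -1)
    (hmem : ∀ u v : ℝ, 0 ≤ u → 0 ≤ v → u + v ≤ 1 →
      (((B₁ : ℝ) + σ * u) / N, ((B₂ : ℝ) + σ * v) / N) ∈ K)
    (hB : ∀ a b : ℤ, IsRefNode a b → 0 ≤ 2 * B₁ + σ * a ∧ 2 * B₁ + σ * a ≤ 2 * N ∧
      0 ≤ 2 * B₂ + σ * b ∧ 2 * B₂ + σ * b ≤ 2 * N)
    {u v : ℝ} (hu : 0 ≤ u) (hv : 0 ≤ v) (huv : u + v ≤ 1) :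
    nodalBasis m (((B₁ : ℝ) + σ * u) / N, ((B₂ : ℝ) + σ * v) / N) =
      quadPoly (fun i => (shapeCoeff (σ * ((m.1 : ℕ) + 1 - 2 * B₁))
        (σ * ((m.2 : ℕ) + 1 - 2 * B₂)) i : ℝ)) u v := by
  obtain ⟨p, hp, hpK⟩ := (nodalBasis_mem m).2.1 K hK
  obtain ⟨q, hq⟩ := exists_quadPoly_of_totalDegree_le hp
  obtain ⟨q', hq'⟩ := quadPoly_comp_affine q ((B₁ : ℝ) / N) ((B₂ : ℝ) / N) ((σ : ℝ) / N)
  have key : ∀ u v : ℝ, 0 ≤ u → 0 ≤ v → u + v ≤ 1 →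
      nodalBasis m (((B₁ : ℝ) + σ * u) / N, ((B₂ : ℝ) + σ * v) / N) = quadPoly q' u v := by
    intro u v hu hv huv
    rw [hpK _ (hmem u v hu hv huv), hq, ← hq']
    congr 1 <;> ring
  rw [key u v hu hv huv]
  refine quadPoly_eq_shape (fun a b hab => ?_) u v
  obtain ⟨ha, hb, hab'⟩ := id hab
  have ha' : (0 : ℝ) ≤ a := by exact_mod_cast ha
  have hb' : (0 : ℝ) ≤ b := by exact_mod_cast hb
  have hab'' : (a : ℝ) + b ≤ 2 := by exact_mod_cast hab'
  rw [← key _ _ (by linarith) (by linarith) (by linarith)]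
  obtain ⟨h1, h2, h3, h4⟩ := hB a b hab
  have hnode := nodalBasis_node m h1 h2 h3 h4
  have e : ∀ (B c : ℤ), ((B : ℝ) + σ * ((c : ℝ) / 2)) / N =
      ((2 * B + σ * c : ℤ) : ℝ) / (2 * N) := by
    intro B c
    have hN0 : (N : ℝ) ≠ 0 := by
      have := m.1.2
      exact_mod_cast (by omega : N ≠ 0)
    push_cast
    field_simp
  rw [e, e, hnode]
  refine if_congr ?_ rfl rfl
  rcases hσ with rfl | rfl <;> omega

/-! Integration over the triangles of the mesh -/

/-- The open reference triangle. -/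
def refTriangle : Set (ℝ × ℝ) := {y | 0 < y.1 ∧ 0 < y.2 ∧ y.1 + y.2 < 1}

theorem isOpen_refTriangle : IsOpen refTriangle :=
  (isOpen_lt continuous_const continuous_fst).inter
    ((isOpen_lt continuous_const continuous_snd).inter
      (isOpen_lt (continuous_fst.add continuous_snd) continuous_const))

/-- The Dirichlet integrand of two quadratic polynomials. -/
def dirichletDensity (q q' : Fin 6 → ℤ) (y : ℝ × ℝ) : ℝ :=
  (q 1 + 2 * q 3 * y.1 + q 4 * y.2) * (q' 1 + 2 * q' 3 * y.1 + q' 4 * y.2) +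
    (q 2 + q 4 * y.1 + 2 * q 5 * y.2) * (q' 2 + q' 4 * y.1 + 2 * q' 5 * y.2)

theorem integral_cubic (a b c₀ c₁ c₂ c₃ : ℝ) :
    ∫ x in a..b, (c₀ + c₁ * x + c₂ * x ^ 2 + c₃ * x ^ 3) =
      c₀ * (b - a) + c₁ * ((b ^ 2 - a ^ 2) / 2) + c₂ * ((b ^ 3 - a ^ 3) / 3) +
        c₃ * ((b ^ 4 - a ^ 4) / 4) := by
  have hi : ∀ f : ℝ → ℝ, Continuous f → IntervalIntegrable f volume a b :=
    fun f hf => hf.intervalIntegrable a b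
  have h1 : ∫ x in a..b, c₁ * x = c₁ * ((b ^ 2 - a ^ 2) / 2) := by
    have := intervalIntegral.integral_const_mul (a := a) (b := b) (μ := volume) c₁ fun x => x
    rw [this, integral_id]
  rw [intervalIntegral.integral_add (hi _ (by fun_prop)) (hi _ (by fun_prop)),
    intervalIntegral.integral_add (hi _ (by fun_prop)) (hi _ (by fun_prop)),
    intervalIntegral.integral_add (hi _ (by fun_prop)) (hi _ (by fun_prop))]
  simp only [h1, intervalIntegral.integral_const_mul, integral_pow,
    intervalIntegral.integral_const, smul_eq_mul]
  norm_num
  ring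

theorem integrable_indicator_refTriangle {g : ℝ × ℝ → ℝ} (hg : Continuous g) :
    Integrable (refTriangle.indicator g) := by
  rw [integrable_indicator_iff isOpen_refTriangle.measurableSet]
  refine (hg.continuousOn.integrableOn_compact
    ((isCompact_Icc (a := (0 : ℝ)) (b := 1)).prod (isCompact_Icc (a := (0 : ℝ)) (b := 1)))).mono_set
    ?_
  rintro y ⟨h1, h2, h3⟩
  exact ⟨⟨h1.le, by linarith⟩, ⟨h2.le, by linarith⟩⟩

/-- Fubini: the inner integral over `0 < v < 1 - u` is a cubic in `u`. The weights are 24 times the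
moments `1/2, 1/6, 1/6, 1/12, 1/24, 1/12`. -/
theorem integral_refTriangle_quadPoly (q : Fin 6 → ℝ) :
    ∫ y, refTriangle.indicator (fun y => quadPoly q y.1 y.2) y =
      (12 * q 0 + 4 * q 1 + 4 * q 2 + 2 * q 3 + q 4 + 2 * q 5) / 24 := by
  have hcont : Continuous fun y : ℝ × ℝ => quadPoly q y.1 y.2 := by
    unfold quadPoly
    fun_prop
  have hint := integrable_indicator_refTriangle hcont
  rw [Measure.volume_eq_prod] at hint ⊢
  rw [integral_prod _ hint]
  have hinner : ∀ u : ℝ, ∫ v, refTriangle.indicator (fun y => quadPoly q y.1 y.2) (u, v) =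
      (Ioc (0 : ℝ) 1).indicator (fun u => (q 0 + q 2 / 2 + q 5 / 3) +
        (-q 0 + q 1 - q 2 + q 4 / 2 - q 5) * u + (-q 1 + q 2 / 2 + q 3 - q 4 + q 5) * u ^ 2 +
        (-q 3 + q 4 / 2 - q 5 / 3) * u ^ 3) u := by
    intro u
    by_cases hu : 0 < u ∧ u < 1
    · have h1 : ∀ v, refTriangle.indicator (fun y => quadPoly q y.1 y.2) (u, v) =
          (Ioo (0 : ℝ) (1 - u)).indicator (fun v => quadPoly q u v) v := by
        intro v
        by_cases hv : 0 < v ∧ v < 1 - u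
        · rw [indicator_of_mem (show (u, v) ∈ refTriangle from
            ⟨hu.1, hv.1, by have := hv.2; simp only; linarith⟩),
            indicator_of_mem (show v ∈ Ioo 0 (1 - u) from hv)]
        · rw [indicator_of_notMem, indicator_of_notMem (show v ∉ Ioo 0 (1 - u) from hv)]
          rintro ⟨-, h, h'⟩
          exact hv ⟨h, by simp only at h'; linarith⟩
      simp_rw [h1]
      rw [integral_indicator measurableSet_Ioo, ← integral_Ioc_eq_integral_Ioo,
        ← intervalIntegral.integral_of_le (by linarith), indicator_of_mem (show u ∈ Ioc (0 : ℝ) 1 from ⟨hu.1, hu.2.le⟩)]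
      have h2 : ∀ v, quadPoly q u v = (q 0 + q 1 * u + q 3 * u ^ 2) + (q 2 + q 4 * u) * v +
          q 5 * v ^ 2 + 0 * v ^ 3 := by
        intro v
        unfold quadPoly
        ring
      simp_rw [h2]
      rw [integral_cubic]
      ring
    · have h1 : ∀ v, refTriangle.indicator (fun y => quadPoly q y.1 y.2) (u, v) = 0 := by
        intro v
        refine indicator_of_notMem ?_ _
        rintro ⟨h, h', h''⟩
        exact hu ⟨h, by simp only at h' h''; linarith⟩
      simp_rw [h1]
      rw [integral_zero]
      -- The endpoint `u = 1` belongs to `Ioc 0 1` although its slice is empty; the cubic vanishes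
      -- there.
      by_cases hu1 : u = 1
      · subst hu1
        rw [indicator_of_mem (by simp)]
        ring
      · rw [indicator_of_notMem]
        rintro ⟨h, h'⟩
        exact hu ⟨h, lt_of_le_of_ne h' hu1⟩
  simp_rw [hinner]
  rw [integral_indicator measurableSet_Ioc, ← intervalIntegral.integral_of_le zero_le_one,
    integral_cubic]
  ring

theorem continuous_dirichletDensity (q q' : Fin 6 → ℤ) : Continuous (dirichletDensity q q') := by
  unfold dirichletDensity
  fun_prop

theorem integral_refTriangle_dirichletDensity (q q' : Fin 6 → ℤ) :
    ∫ y, refTriangle.indicator (dirichletDensity q q') y = (quadDirichlet q q' : ℝ) / 24 := by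
  have h : dirichletDensity q q' = fun y => quadPoly
      ![(q 1 * q' 1 + q 2 * q' 2 : ℝ),
        q 1 * (2 * q' 3) + 2 * q 3 * q' 1 + q 2 * q' 4 + q 4 * q' 2,
        q 1 * q' 4 + q 4 * q' 1 + q 2 * (2 * q' 5) + 2 * q 5 * q' 2,
        2 * q 3 * (2 * q' 3) + q 4 * q' 4,
        2 * q 3 * q' 4 + q 4 * (2 * q' 3) + q 4 * (2 * q' 5) + 2 * q 5 * q' 4,
        q 4 * q' 4 + 2 * q 5 * (2 * q' 5)] y.1 y.2 := by
    funext y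
    simp only [dirichletDensity, quadPoly, Matrix.cons_val]
    ring
  rw [h, integral_refTriangle_quadPoly]
  simp only [Matrix.cons_val, quadDirichlet, affineGram]
  push_cast
  ring

/-- The map of a mesh triangle onto the reference triangle. -/
def refMap (R : ℝ) (b x : ℝ × ℝ) : ℝ × ℝ := R • x - b

theorem integrable_comp_refMap {R : ℝ} (hR : R ≠ 0) (b : ℝ × ℝ) {g : ℝ × ℝ → ℝ}
    (hg : Integrable g) : Integrable fun x => g (refMap R b x) :=
  (hg.comp_sub_right b).comp_smul hR

theorem integral_comp_refMap (R : ℝ) (b : ℝ × ℝ) (g : ℝ × ℝ → ℝ) :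
    ∫ x, g (refMap R b x) = (R ^ 2)⁻¹ * ∫ y, g y := by
  have h := Measure.integral_comp_smul (volume : Measure (ℝ × ℝ)) (fun x => g (x - b)) R
  unfold refMap
  rw [h, integral_sub_right_eq_self g b]
  simp [abs_of_nonneg, sq_nonneg]

/-- Almost every point lies off the lines of the mesh. -/
theorem ae_not_mem_mesh_lines {N : ℕ} (hN : 0 < N) : ∀ᵐ x : ℝ × ℝ, ∀ k : ℤ,
    N * x.1 ≠ k ∧ N * x.2 ≠ k ∧ N * x.1 + N * x.2 ≠ k := by
  rw [ae_all_iff]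
  intro k
  have hN' : (N : ℝ) ≠ 0 := by positivity
  have h0 : ∀ᵐ t : ℝ, t ≠ k / N := by simp [ae_iff]
  have h1 : ∀ᵐ x : ℝ × ℝ, x.1 ≠ k / N := Measure.quasiMeasurePreserving_fst.ae h0
  have h2 : ∀ᵐ x : ℝ × ℝ, x.2 ≠ k / N := Measure.quasiMeasurePreserving_snd.ae h0
  -- The shear `(s, t) ↦ (s, s + t)` preserves measure and turns diagonal lines into horizontal
  -- ones.
  have h3 : ∀ᵐ x : ℝ × ℝ, x.1 + x.2 ≠ k / N :=
    (Measure.quasiMeasurePreserving_snd.comp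
      (measurePreserving_prod_add (volume : Measure ℝ) volume).quasiMeasurePreserving).ae h0
  filter_upwards [h1, h2, h3] with x g1 g2 g3
  refine ⟨fun h => g1 ?_, fun h => g2 ?_, fun h => g3 ?_⟩
  · rw [eq_div_iff hN', ← h]; ring
  · rw [eq_div_iff hN', ← h]; ring
  · rw [eq_div_iff hN', ← h]; ring

/-! The entries of the stiffness matrix -/

/-- The affine map of a mesh triangle, with right angle at `(B₁ / N, B₂ / N)` and orientation
`σ = ±1`, onto the reference triangle. -/
def meshChart (N : ℕ) (σ B₁ B₂ : ℤ) : ℝ × ℝ → ℝ × ℝ :=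
  refMap ((σ : ℝ) * N) ((σ : ℝ) * B₁, (σ : ℝ) * B₂)

theorem meshChart_apply (N : ℕ) (σ B₁ B₂ : ℤ) (x : ℝ × ℝ) :
    meshChart N σ B₁ B₂ x = ((σ : ℝ) * N * x.1 - σ * B₁, (σ : ℝ) * N * x.2 - σ * B₂) := rfl

/-- The map `meshChart N σ B₁ B₂` belongs to a triangle of the mesh. -/
structure IsMeshTriangle (N : ℕ) (σ B₁ B₂ : ℤ) : Prop where
  sign : σ = 1 ∨ σ = -1
  exists_triangle : ∃ K ∈ friedrichsKeller N, ∀ u v : ℝ, 0 ≤ u → 0 ≤ v → u + v ≤ 1 →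
    (((B₁ : ℝ) + σ * u) / N, ((B₂ : ℝ) + σ * v) / N) ∈ K
  nodes : ∀ a b : ℤ, IsRefNode a b → 0 ≤ 2 * B₁ + σ * a ∧ 2 * B₁ + σ * a ≤ 2 * N ∧
    0 ≤ 2 * B₂ + σ * b ∧ 2 * B₂ + σ * b ≤ 2 * N

theorem isMeshTriangle_lower {N i j : ℕ} (hi : i < N) (hj : j < N) :
    IsMeshTriangle N 1 i j where
  sign := Or.inl rfl
  exists_triangle := ⟨lowerTriangle N i j, ⟨i, hi, j, hj, Or.inl rfl⟩, fun u v hu hv huv => by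
    simpa using mem_lowerTriangle (N := N) i j hu hv huv⟩
  nodes a b h := by
    obtain ⟨h1, h2, h3⟩ := h
    omega

theorem isMeshTriangle_upper {N i j : ℕ} (hi : i < N) (hj : j < N) :
    IsMeshTriangle N (-1) (i + 1) (j + 1) where
  sign := Or.inr rfl
  exists_triangle := ⟨upperTriangle N i j, ⟨i, hi, j, hj, Or.inr rfl⟩, fun u v hu hv huv => by
    simpa [sub_eq_add_neg] using mem_upperTriangle (N := N) i j hu hv huv⟩
  nodes a b h := by
    obtain ⟨h1, h2, h3⟩ := h
    omega

/-- The coefficients of a nodal basis function on a triangle of the mesh. -/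
def nodeShape {N : ℕ} (m : P2Node N) (σ B₁ B₂ : ℤ) : Fin 6 → ℤ :=
  shapeCoeff (σ * ((m.1 : ℕ) + 1 - 2 * B₁)) (σ * ((m.2 : ℕ) + 1 - 2 * B₂))

theorem continuous_meshChart (N : ℕ) (σ B₁ B₂ : ℤ) : Continuous (meshChart N σ B₁ B₂) := by
  unfold meshChart refMap
  fun_prop

/-- Equality on a neighbourhood, not just at `x`, is what allows derivatives to be compared; it
holds because the reference triangle is open. -/
theorem nodalBasis_eventuallyEq {N : ℕ} (m : P2Node N) {σ B₁ B₂ : ℤ}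
    (h : IsMeshTriangle N σ B₁ B₂) {x : ℝ × ℝ} (hx : meshChart N σ B₁ B₂ x ∈ refTriangle) :
    nodalBasis m =ᶠ[𝓝 x] fun x => quadPoly (fun i => (nodeShape m σ B₁ B₂ i : ℝ))
      (meshChart N σ B₁ B₂ x).1 (meshChart N σ B₁ B₂ x).2 := by
  obtain ⟨K, hK, hmem⟩ := h.exists_triangle
  have hN0 : (N : ℝ) ≠ 0 := by
    have := m.1.2
    exact_mod_cast (by omega : N ≠ 0)
  have hσ : (σ : ℝ) * σ = 1 := by
    rcases h.sign with rfl | rfl <;> norm_num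
  filter_upwards [(isOpen_refTriangle.preimage (continuous_meshChart N σ B₁ B₂)).mem_nhds hx]
    with y hy
  obtain ⟨h1, h2, h3⟩ := hy
  have key := nodalBasis_eq_shape m hK h.sign hmem h.nodes h1.le h2.le h3.le
  rw [nodeShape, ← key]
  congr 1
  rw [meshChart_apply]
  have e : ∀ (B : ℤ) (t : ℝ), ((B : ℝ) + σ * (σ * N * t - σ * B)) / N = t := by
    intro B t
    rw [div_eq_iff hN0]
    linear_combination (N * t - B) * hσ
  ext
  · exact (e B₁ y.1).symm
  · exact (e B₂ y.2).symm

theorem fderiv_quadPoly_meshChart (c : Fin 6 → ℝ) (N : ℕ) (σ B₁ B₂ : ℤ) (x w : ℝ × ℝ) :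
    fderiv ℝ (fun x => quadPoly c (meshChart N σ B₁ B₂ x).1 (meshChart N σ B₁ B₂ x).2) x w =
      σ * N * ((c 1 + 2 * c 3 * (meshChart N σ B₁ B₂ x).1 + c 4 * (meshChart N σ B₁ B₂ x).2) * w.1 +
        (c 2 + c 4 * (meshChart N σ B₁ B₂ x).1 + 2 * c 5 * (meshChart N σ B₁ B₂ x).2) * w.2) := by
  have hu : HasFDerivAt (fun x : ℝ × ℝ => (meshChart N σ B₁ B₂ x).1)
      (((σ : ℝ) * N) • ContinuousLinearMap.fst ℝ ℝ ℝ) x :=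
    ((hasFDerivAt_fst (𝕜 := ℝ) (p := x)).const_mul ((σ : ℝ) * N)).sub_const _
  have hv : HasFDerivAt (fun x : ℝ × ℝ => (meshChart N σ B₁ B₂ x).2)
      (((σ : ℝ) * N) • ContinuousLinearMap.snd ℝ ℝ ℝ) x :=
    ((hasFDerivAt_snd (𝕜 := ℝ) (p := x)).const_mul ((σ : ℝ) * N)).sub_const _
  have h := (((((hasFDerivAt_const (c 0) x).add (hu.const_mul (c 1))).add
    (hv.const_mul (c 2))).add ((hu.pow 2).const_mul (c 3))).add
    ((hu.mul hv).const_mul (c 4))).add ((hv.pow 2).const_mul (c 5))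
  have h' : HasFDerivAt
      (fun x => quadPoly c (meshChart N σ B₁ B₂ x).1 (meshChart N σ B₁ B₂ x).2) _ x := h
  rw [h'.fderiv]
  simp
  ring

/-- The integrand of a stiffness matrix entry. -/
def stiffnessDensity {N : ℕ} (p q : P2Node N) (x : ℝ × ℝ) : ℝ :=
  1 * (fderiv ℝ (nodalBasis q) x (1, 0) * fderiv ℝ (nodalBasis p) x (1, 0) +
    fderiv ℝ (nodalBasis q) x (0, 1) * fderiv ℝ (nodalBasis p) x (0, 1))

theorem stiffnessDensity_eq {N : ℕ} (p q : P2Node N) {σ B₁ B₂ : ℤ}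
    (h : IsMeshTriangle N σ B₁ B₂) {x : ℝ × ℝ} (hx : meshChart N σ B₁ B₂ x ∈ refTriangle) :
    stiffnessDensity p q x = N ^ 2 *
      dirichletDensity (nodeShape p σ B₁ B₂) (nodeShape q σ B₁ B₂) (meshChart N σ B₁ B₂ x) := by
  have hσ : (σ : ℝ) ^ 2 = 1 := by
    rcases h.sign with rfl | rfl <;> norm_num
  trans (σ : ℝ) ^ 2 * (N ^ 2 *
    dirichletDensity (nodeShape p σ B₁ B₂) (nodeShape q σ B₁ B₂) (meshChart N σ B₁ B₂ x))
  · rw [stiffnessDensity, (nodalBasis_eventuallyEq p h hx).fderiv_eq,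
      (nodalBasis_eventuallyEq q h hx).fderiv_eq]
    simp only [fderiv_quadPoly_meshChart, dirichletDensity]
    ring
  · rw [hσ, one_mul]

/-- The contribution of a triangle to the integrand of a stiffness matrix entry. -/
def trianglePart {N : ℕ} (p q : P2Node N) (σ B₁ B₂ : ℤ) (x : ℝ × ℝ) : ℝ :=
  N ^ 2 * refTriangle.indicator
    (dirichletDensity (nodeShape p σ B₁ B₂) (nodeShape q σ B₁ B₂)) (meshChart N σ B₁ B₂ x)

theorem trianglePart_of_mem {N : ℕ} (p q : P2Node N) {σ B₁ B₂ : ℤ}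
    (h : IsMeshTriangle N σ B₁ B₂) {x : ℝ × ℝ} (hx : meshChart N σ B₁ B₂ x ∈ refTriangle) :
    trianglePart p q σ B₁ B₂ x = stiffnessDensity p q x := by
  rw [trianglePart, indicator_of_mem hx, stiffnessDensity_eq p q h hx]

theorem trianglePart_of_notMem {N : ℕ} (p q : P2Node N) {σ B₁ B₂ : ℤ} {x : ℝ × ℝ}
    (hx : meshChart N σ B₁ B₂ x ∉ refTriangle) : trianglePart p q σ B₁ B₂ x = 0 := by
  rw [trianglePart, indicator_of_notMem hx, mul_zero]

theorem scale_ne_zero {N : ℕ} (hN : 0 < N) {σ : ℤ} (hσ : σ = 1 ∨ σ = -1) : (σ : ℝ) * N ≠ 0 := by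
  have : (N : ℝ) ≠ 0 := by positivity
  rcases hσ with rfl | rfl <;> simpa using this

theorem integrable_trianglePart {N : ℕ} (hN : 0 < N) (p q : P2Node N) {σ : ℤ}
    (hσ : σ = 1 ∨ σ = -1) (B₁ B₂ : ℤ) : Integrable (trianglePart p q σ B₁ B₂) :=
  (integrable_comp_refMap (scale_ne_zero hN hσ) _
    (integrable_indicator_refTriangle (continuous_dirichletDensity _ _))).const_mul _

/-- Scale invariance of the Dirichlet form in dimension two: the factor `N ^ 2` from the two
gradients cancels the Jacobian, so the result does not depend on the mesh width. -/
theorem integral_trianglePart {N : ℕ} (hN : 0 < N) (p q : P2Node N) {σ : ℤ}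
    (hσ : σ = 1 ∨ σ = -1) (B₁ B₂ : ℤ) : ∫ x, trianglePart p q σ B₁ B₂ x =
      (quadDirichlet (nodeShape p σ B₁ B₂) (nodeShape q σ B₁ B₂) : ℝ) / 24 := by
  have hN' : (N : ℝ) ≠ 0 := by positivity
  have hσ' : (σ : ℝ) ^ 2 = 1 := by
    rcases hσ with rfl | rfl <;> norm_num
  unfold trianglePart meshChart
  rw [integral_const_mul, integral_comp_refMap, integral_refTriangle_dirichletDensity, mul_pow,
    hσ', one_mul, ← mul_assoc, mul_inv_cancel₀ (pow_ne_zero 2 hN'), one_mul]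

theorem meshChart_lower_mem {N : ℕ} (i j : ℕ) (x : ℝ × ℝ) :
    meshChart N 1 i j x ∈ refTriangle ↔
      (i : ℝ) < N * x.1 ∧ (j : ℝ) < N * x.2 ∧ N * x.1 + N * x.2 < i + j + 1 := by
  simp only [meshChart_apply, refTriangle, mem_ofPred_eq]
  push_cast
  constructor <;> rintro ⟨h1, h2, h3⟩ <;> refine ⟨?_, ?_, ?_⟩ <;> linarith

theorem meshChart_upper_mem {N : ℕ} (i j : ℕ) (x : ℝ × ℝ) :
    meshChart N (-1) (i + 1) (j + 1) x ∈ refTriangle ↔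
      N * x.1 < (i : ℝ) + 1 ∧ N * x.2 < (j : ℝ) + 1 ∧ i + j + 1 < N * x.1 + N * x.2 := by
  simp only [meshChart_apply, refTriangle, mem_ofPred_eq]
  push_cast
  constructor <;> rintro ⟨h1, h2, h3⟩ <;> refine ⟨?_, ?_, ?_⟩ <;> linarith

theorem cell_of_meshChart_mem {N : ℕ} {i j : ℕ} {x : ℝ × ℝ}
    (h : meshChart N 1 i j x ∈ refTriangle ∨
      meshChart N (-1) (i + 1) (j + 1) x ∈ refTriangle) :
    (i : ℝ) < N * x.1 ∧ N * x.1 < i + 1 ∧ (j : ℝ) < N * x.2 ∧ N * x.2 < j + 1 := by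
  rw [meshChart_lower_mem, meshChart_upper_mem] at h
  rcases h with ⟨h1, h2, h3⟩ | ⟨h1, h2, h3⟩ <;> refine ⟨?_, ?_, ?_, ?_⟩ <;> linarith

/-- Off the mesh lines a point of the square lies in exactly one open triangle: floors give its
cell, and the side of the diagonal selects the half. -/
theorem indicator_stiffnessDensity_eq_sum {N : ℕ} (hN : 0 < N) (p q : P2Node N) {x : ℝ × ℝ}
    (hx : ∀ k : ℤ, N * x.1 ≠ k ∧ N * x.2 ≠ k ∧ N * x.1 + N * x.2 ≠ k) :
    unitSquare.indicator (stiffnessDensity p q) x =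
      ∑ i ∈ Finset.range N, ∑ j ∈ Finset.range N,
        (trianglePart p q 1 i j x + trianglePart p q (-1) (i + 1) (j + 1) x) := by
  have hN' : (0 : ℝ) < N := by positivity
  have hzero : ∀ i j : ℕ,
      ¬ ((i : ℝ) < N * x.1 ∧ N * x.1 < i + 1 ∧ (j : ℝ) < N * x.2 ∧ N * x.2 < j + 1) →
      trianglePart p q 1 i j x + trianglePart p q (-1) (i + 1) (j + 1) x = 0 := by
    intro i j hij
    rw [trianglePart_of_notMem p q fun h => hij (cell_of_meshChart_mem (Or.inl h)),
      trianglePart_of_notMem p q fun h => hij (cell_of_meshChart_mem (Or.inr h)), add_zero]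
  by_cases hxs : x ∈ unitSquare
  · obtain ⟨⟨h1, h2⟩, h3, h4⟩ := id hxs
    have g1 : 0 < N * x.1 := mul_pos hN' h1
    have g2 : N * x.1 < N := by nlinarith
    have g3 : 0 < N * x.2 := mul_pos hN' h3
    have g4 : N * x.2 < N := by nlinarith
    set i₀ := ⌊N * x.1⌋₊ with hi₀
    set j₀ := ⌊N * x.2⌋₊ with hj₀
    have a1 : (i₀ : ℝ) < N * x.1 :=
      lt_of_le_of_ne (Nat.floor_le g1.le) fun h => (hx i₀).1 (by simpa using h.symm)
    have a2 : N * x.1 < i₀ + 1 := Nat.lt_floor_add_one _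
    have a3 : (j₀ : ℝ) < N * x.2 :=
      lt_of_le_of_ne (Nat.floor_le g3.le) fun h => (hx j₀).2.1 (by simpa using h.symm)
    have a4 : N * x.2 < j₀ + 1 := Nat.lt_floor_add_one _
    have hi₀N : i₀ < N := by exact_mod_cast a1.trans g2
    have hj₀N : j₀ < N := by exact_mod_cast a3.trans g4
    have huniq : ∀ {i : ℕ} {t : ℝ}, 0 ≤ t → (i : ℝ) < t → t < i + 1 → i = ⌊t⌋₊ :=
      fun ht h h' => ((Nat.floor_eq_iff ht).mpr ⟨h.le, h'⟩).symm
    rw [indicator_of_mem hxs, Finset.sum_eq_single i₀, Finset.sum_eq_single j₀]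
    · rcases lt_or_gt_of_ne (hx (i₀ + j₀ + 1)).2.2 with h | h <;> push_cast at h
      · rw [trianglePart_of_mem p q (isMeshTriangle_lower hi₀N hj₀N)
          ((meshChart_lower_mem i₀ j₀ x).mpr ⟨a1, a3, h⟩), trianglePart_of_notMem, add_zero]
        rw [meshChart_upper_mem]
        rintro ⟨-, -, h'⟩
        linarith
      · rw [trianglePart_of_mem p q (isMeshTriangle_upper hi₀N hj₀N)
          ((meshChart_upper_mem i₀ j₀ x).mpr ⟨a2, a4, h⟩), trianglePart_of_notMem, zero_add]
        rw [meshChart_lower_mem]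
        rintro ⟨-, -, h'⟩
        linarith
    · intro j _ hj
      exact hzero _ _ fun h => hj (huniq g3.le h.2.2.1 h.2.2.2)
    · intro h
      exact absurd (Finset.mem_range.mpr hj₀N) h
    · intro i _ hi
      exact Finset.sum_eq_zero fun j _ => hzero _ _ fun h => hi (huniq g1.le h.1 h.2.1)
    · intro h
      exact absurd (Finset.mem_range.mpr hi₀N) h
  · rw [indicator_of_notMem hxs]
    refine (Finset.sum_eq_zero fun i hi => Finset.sum_eq_zero fun j hj => hzero i j ?_).symm
    rintro ⟨h1, h2, h3, h4⟩
    refine hxs ?_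
    have hpos : ∀ {k : ℕ} {t : ℝ}, (k : ℝ) < N * t → 0 < t := fun {k t} h =>
      pos_of_mul_pos_right ((Nat.cast_nonneg k).trans_lt h) hN'.le
    have hlt : ∀ {k : ℕ} {t : ℝ}, k ∈ Finset.range N → N * t < k + 1 → t < 1 := by
      intro k t hk h
      have : (k : ℝ) + 1 ≤ N := by exact_mod_cast Finset.mem_range.mp hk
      nlinarith
    exact ⟨⟨hpos h1, hlt hi h2⟩, hpos h3, hlt hj h4⟩

/-- Assembly of a stiffness matrix entry from the cells of the mesh. -/
theorem stiffnessP2_eq_sum {N : ℕ} (p q : P2Node N) :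
    stiffnessP2 (fun _ => 1) N p q = ((∑ i ∈ Finset.range N, ∑ j ∈ Finset.range N,
      cellStiffness ((p.1 : ℕ) + 1 - 2 * i) ((p.2 : ℕ) + 1 - 2 * j)
        ((q.1 : ℕ) + 1 - 2 * i) ((q.2 : ℕ) + 1 - 2 * j) : ℤ) : ℝ) / 24 := by
  have hN : 0 < N := by
    have := p.1.2
    omega
  have hms : MeasurableSet unitSquare := measurableSet_Ioo.prod measurableSet_Ioo
  have h1 : stiffnessP2 (fun _ => 1) N p q = ∫ x in unitSquare, stiffnessDensity p q x := rfl
  rw [h1, ← integral_indicator hms, integral_congr_ae (g := fun x =>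
    ∑ i ∈ Finset.range N, ∑ j ∈ Finset.range N,
      (trianglePart p q 1 i j x + trianglePart p q (-1) (i + 1) (j + 1) x))
    ((ae_not_mem_mesh_lines hN).mono fun x hx => indicator_stiffnessDensity_eq_sum hN p q hx)]
  have hl : ∀ i j : ℕ, Integrable (trianglePart p q 1 i j) := fun i j =>
    integrable_trianglePart hN p q (Or.inl rfl) _ _
  have hu : ∀ i j : ℕ, Integrable (trianglePart p q (-1) (i + 1) (j + 1)) := fun i j =>
    integrable_trianglePart hN p q (Or.inr rfl) _ _
  have hlu : ∀ i j : ℕ, Integrable fun x =>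
      trianglePart p q 1 i j x + trianglePart p q (-1) (i + 1) (j + 1) x := fun i j =>
    (hl i j).add (hu i j)
  rw [integral_finsetSum _ fun i _ => integrable_finsetSum _ fun j _ => hlu i j]
  push_cast
  rw [Finset.sum_div]
  refine Finset.sum_congr rfl fun i _ => ?_
  rw [integral_finsetSum _ fun j _ => hlu i j, Finset.sum_div]
  refine Finset.sum_congr rfl fun j _ => ?_
  -- For the upper triangle, `σ = -1` and right angle at `(i + 1, j + 1)` turn a relative position
  -- `a` into `2 - a`, as in `cellStiffness`.
  rw [integral_add (hl i j) (hu i j), integral_trianglePart hN p q (Or.inl rfl),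
    integral_trianglePart hN p q (Or.inr rfl), ← add_div, cellStiffness, localStiffness,
    localStiffness, nodeShape, nodeShape, nodeShape, nodeShape]
  push_cast
  ring_nf

/-! ### The stiffness matrix as a principal submatrix of the Toeplitz matrix -/

theorem sum_range_eq_sum_shift {M : Type*} [AddCommMonoid M] {N I x : ℕ} (h : I + x < N)
    (g : ℕ → M) (hg : ∀ i, i < I ∨ I + x < i → g i = 0) :
    ∑ i ∈ Finset.range N, g i = ∑ s ∈ Finset.range (x + 1), g (I + s) := by
  have h1 := Finset.sum_Ico_eq_sum_range g I (I + (x + 1))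
  rw [Nat.add_sub_cancel_left] at h1
  rw [← h1]
  symm
  refine Finset.sum_subset (fun i hi => ?_) fun i _ hi => hg i ?_
  · rw [Finset.mem_Ico] at hi
    rw [Finset.mem_range]
    omega
  · rw [Finset.mem_Ico] at hi
    omega

/-- The block of a node. -/
def nodeBlock {N : ℕ} (k : Fin (2 * N - 1)) : Fin N := ⟨(k : ℕ) / 2, by omega⟩

/-- The parity of a coordinate of a node. -/
def nodeParity {N : ℕ} (k : Fin (2 * N - 1)) : Fin 2 := ⟨(k : ℕ) % 2, by omega⟩

theorem node_eq {N : ℕ} (k : Fin (2 * N - 1)) :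
    (k : ℕ) = 2 * (nodeBlock k : ℕ) + (nodeParity k : ℕ) := by
  simp only [nodeBlock, nodeParity]
  omega

/-- The largest index `2N - 2` is even, so a node of parity `1` is never in the last block. All
cells around an internal node therefore exist, and the stencil is the same near the boundary. -/
theorem nodeBlock_add_parity_lt {N : ℕ} (k : Fin (2 * N - 1)) :
    (nodeBlock k : ℕ) + (nodeParity k : ℕ) < N := by
  simp only [nodeBlock, nodeParity]
  omega

/-- The embedding of the internal nodes into the indices of the block Toeplitz matrix. -/
def nodeEmb (N : ℕ) : P2Node N ↪ (Fin N × Fin N) × Fin 4 where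
  toFun p := ((nodeBlock p.1, nodeBlock p.2), parityIndex (nodeParity p.1) (nodeParity p.2))
  inj' := by
    rintro ⟨k, l⟩ ⟨k', l'⟩ h
    simp only [nodeBlock, nodeParity, parityIndex, Prod.mk.injEq, Fin.mk.injEq] at h
    ext <;> simp only <;> omega

/-- Of all the cells only those touching the first node contribute; shifting the cell indices by its
block leaves a sum depending on the parities and the block difference alone. -/
theorem stiffnessP2_eq_stencil {N : ℕ} (p q : P2Node N) :
    stiffnessP2 (fun _ => 1) N p q =
      (p2Stencil (parityIndex (nodeParity p.1) (nodeParity p.2))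
        (parityIndex (nodeParity q.1) (nodeParity q.2))
        ((nodeBlock p.1 : ℕ) - (nodeBlock q.1 : ℕ)) ((nodeBlock p.2 : ℕ) - (nodeBlock q.2 : ℕ)) :
          ℝ) / 24 := by
  rw [stiffnessP2_eq_sum, ← sum_cellStiffness (m := (_, _))]
  congr 2
  have e1 := node_eq p.1
  have e2 := node_eq p.2
  have e3 := node_eq q.1
  have e4 := node_eq q.2
  have b1 := nodeBlock_add_parity_lt p.1
  have b2 := nodeBlock_add_parity_lt p.2
  have f1 := (nodeParity p.1).2
  have f2 := (nodeParity p.2).2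
  rw [sum_range_eq_sum_shift b1 _ fun i hi => Finset.sum_eq_zero fun j _ =>
    cellStiffness_eq_zero_left _ _ (by omega)]
  refine Finset.sum_congr rfl fun s _ => ?_
  rw [sum_range_eq_sum_shift b2 _ fun j hj => cellStiffness_eq_zero_left _ _ (by omega)]
  refine Finset.sum_congr rfl fun t _ => ?_
  congr 1 <;> push_cast <;> omega

theorem stiffnessP2_map_eq_submatrix (N : ℕ) :
    (stiffnessP2 (fun _ => 1) N).map (fun t : ℝ => (t : ℂ)) =
      (blockToeplitz N N (polySymbol p2Poly)).submatrix (nodeEmb N) (nodeEmb N) := by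
  ext p q
  rw [Matrix.map_apply, stiffnessP2_eq_stencil, Matrix.submatrix_apply, blockToeplitz,
    Matrix.of_apply, fourierCoeffMatrix_polySymbol, coeff_p2Poly]
  push_cast
  rfl

theorem tendsto_card_P2Node : Tendsto (fun n => (Fintype.card (P2Node n) : ℝ) / (n : ℝ) ^ 2) atTop
    (𝓝 (Fintype.card (Fin 4))) := by
  have h1 : Tendsto (fun n : ℕ => 2 - (1 : ℝ) / (n : ℝ)) atTop (𝓝 (2 - 0)) :=
    (tendsto_const_div_atTop_nhds_zero_nat (1 : ℝ)).const_sub 2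
  have h2 := h1.pow 2
  have h3 : ((2 : ℝ) - 0) ^ 2 = (Fintype.card (Fin 4) : ℝ) := by norm_num
  rw [h3] at h2
  refine h2.congr' ?_
  filter_upwards [eventually_gt_atTop 0] with n hn
  have : (n : ℝ) ≠ 0 := by positivity
  simp only [Fintype.card_prod, Fintype.card_fin]
  rw [Nat.cast_mul, Nat.cast_sub (by omega)]
  push_cast
  field_simp

end

theorem proposition3p3p1 :
    HasSpectralDistribution (fun n : ℕ => blockToeplitz n n symbolP2) torusSquare symbolP2 ∧
    HasSpectralDistribution
      (fun n : ℕ => (stiffnessP2 (fun _ => 1) n).map (fun t : ℝ => (t : ℂ)))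
      torusSquare symbolP2 := by
  rw [symbolP2_eq_polySymbol]
  refine ⟨hasSpectralDistribution_blockToeplitz isHermitianSymbol_p2Poly, ?_⟩
  simp_rw [stiffnessP2_map_eq_submatrix]
  exact hasSpectralDistribution_submatrix_blockToeplitz isHermitianSymbol_p2Poly nodeEmb
    tendsto_card_P2Node
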